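/- Let $(\theta,x,y)$ be the standard coordinates on $S^1\times\mathbb{R}^2$, $S^1=\mathbb{R}/2\pi\mathbb{Z}$, oriented by $d\theta\wedge dx\wedge dy$, and write $S^1$ for $S^1\times\{0\}$. For $i=1,2$ let $\alpha_i$ be a smooth $1$-form on an open neighbourhood $V_i$ of $S^1$ such that $\alpha_i\wedge d\alpha_i$ is a positive multiple of $d\theta\wedge dx\wedge dy$ at every point of $V_i$, so that $\xi_i=\ker\alpha_i$ is a positive contact structure near $S^1$. Suppose that there is a smooth function $\mu\colon S^1\to\mathbb{R}^+$ with $$\alpha_1(\partial_\theta)|_{S^1}=\mu\,\alpha_2(\partial_\theta)|_{S^1}.$$ Then there are an open neighbourhood $U\subset V_1$ of $S^1$ and a contactomorphism $f\colon(U,\xi_1)\to(f(U),\xi_2)$, i.e. a diffeomorphism of $U$ onto an open set $f(U)\subset V_2$ with $Tf(\xi_1)=\xi_2$, that is equal to the identity on $S^1$. In particular, such $U$ and $f$ exist if $S^1$ is Legendrian for both contact structures (that is, $\alpha_1(\partial_\theta)=\alpha_2(\partial_\theta)=0$ along $S^1$), and also if $S^1$ is transverse to both contact structures (that is, $\alpha_1(\partial_\theta)$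 and $\alpha_2(\partial_\theta)$ vanish nowhere along $S^1$). -/

import Mathlib

open scoped Manifold ContDiff
open Bundle

noncomputable section

namespace ContactNbhd

/-- The manifold `S¹ × ℝ²`. -/
abbrev Solid : Type := Circle × EuclideanSpace ℝ (Fin 2)

/-- The model with corners of the smooth manifold `S¹ × ℝ²`. -/
abbrev solidModel :
    ModelWithCorners ℝ (EuclideanSpace ℝ (Fin 1) × EuclideanSpace ℝ (Fin 2))
      (ModelProd (EuclideanSpace ℝ (Fin 1)) (EuclideanSpace ℝ (Fin 2))) :=
  (𝓡 1).prod (𝓡 2)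

/-- The circle `S¹ = S¹ × {0}` in `S¹ × ℝ²`. -/
def core : Set Solid := {p | p.2 = 0}

/-- The universal cover `ℝ × ℝ²` of `S¹ × ℝ²`, with global coordinates `(θ, (x, y))`. -/
abbrev Cover : Type := ℝ × EuclideanSpace ℝ (Fin 2)

/-- The covering map `(θ, (x, y)) ↦ (exp (iθ), (x, y))`. It is a surjective local diffeomorphism,
so that its local inverses are the coordinates `θ, x, y` of `S¹ × ℝ²`. -/
def coverMap (z : Cover) : Solid := (Circle.exp z.1, z.2)

/-- The standard basis vector of the cover in the direction of `θ`. -/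
def eθ : Cover := (1, 0)

/-- The standard basis vector of the cover in the direction of `x`. -/
def eX : Cover := (0, EuclideanSpace.single 0 1)

/-- The standard basis vector of the cover in the direction of `y`. -/
def eY : Cover := (0, EuclideanSpace.single 1 1)

/-- The coordinate vector `∂_θ` of `S¹ × ℝ²` at the point with coordinates `z`. -/
def dTheta (z : Cover) : TangentSpace solidModel (coverMap z) :=
  mfderiv 𝓘(ℝ, Cover) solidModel coverMap z eθ

/-- A (not necessarily continuous) 1-form on `S¹ × ℝ²`. A 1-form that is defined near `S¹` only is
extended arbitrarily; all conditions are imposed on its domain alone. -/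
abbrev OneForm : Type := (p : Solid) → (TangentSpace solidModel p →L[ℝ] ℝ)

/-- The 1-form `α` is smooth on `V`, as a section of the cotangent bundle of `S¹ × ℝ²`. -/
def SmoothOn (α : OneForm) (V : Set Solid) : Prop :=
  ContMDiffOn solidModel
    (solidModel.prod 𝓘(ℝ, (EuclideanSpace ℝ (Fin 1) × EuclideanSpace ℝ (Fin 2)) →L[ℝ] ℝ)) ∞
    (fun p : Solid => TotalSpace.mk'
      ((EuclideanSpace ℝ (Fin 1) × EuclideanSpace ℝ (Fin 2)) →L[ℝ] ℝ)
      (E := fun p : Solid => TangentSpace solidModel p →L[ℝ] Trivial Solid ℝ p) p (α p)) V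

/-- The coordinate expression of a 1-form: its pull-back to the cover. -/
def pullback (α : OneForm) (z : Cover) : Cover →L[ℝ] ℝ :=
  (α (coverMap z)).comp (mfderiv 𝓘(ℝ, Cover) solidModel coverMap z)

/-- The exterior derivative `dA (v, w)` at `z` of a 1-form `A` on the cover. -/
def extDerivOne (A : Cover → (Cover →L[ℝ] ℝ)) (z v w : Cover) : ℝ :=
  extDeriv (fun q => ContinuousAlternatingMap.ofSubsingleton ℝ Cover ℝ (0 : Fin 1) (A q)) z ![v, w]

/-- The 3-form `A ∧ dA` at `z` for a 1-form `A` on the cover, evaluated on three vectors. -/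
def wedgeExtDeriv (A : Cover → (Cover →L[ℝ] ℝ)) (z u v w : Cover) : ℝ :=
  A z u * extDerivOne A z v w + A z v * extDerivOne A z w u + A z w * extDerivOne A z u v

/-- `α` is a smooth 1-form on `V`, and `α ∧ dα` is a positive multiple of `dθ ∧ dx ∧ dy` at each
point of `V`; that is, `ker α` is a positive contact structure on `V`. -/
def IsPositiveContactFormOn (α : OneForm) (V : Set Solid) : Prop :=
  SmoothOn α V ∧ ∀ z : Cover, coverMap z ∈ V → 0 < wedgeExtDeriv (pullback α) z eθ eX eY

/-- There are an open neighbourhood `U` of `S¹`, contained in `V₁`, and a diffeomorphism `f` of `U`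
onto an open subset `f(U)` of `V₂` which is the identity on `S¹` and whose differential maps the
plane field `ker α₁` onto the plane field `ker α₂`. -/
def ContactomorphicNearCore (α₁ α₂ : OneForm) (V₁ V₂ : Set Solid) : Prop :=
  ∃ f : OpenPartialHomeomorph Solid Solid,
    core ⊆ f.source ∧ f.source ⊆ V₁ ∧ f.target ⊆ V₂ ∧
    ContMDiffOn solidModel solidModel ∞ f f.source ∧
    ContMDiffOn solidModel solidModel ∞ f.symm f.target ∧
    (∀ p ∈ f.source,
      Submodule.map (mfderiv solidModel solidModel f p).toLinearMap (α₁ p).ker = (α₂ (f p)).ker) ∧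
    ∀ p ∈ core, f p = p

end ContactNbhd

end

/-! All the analysis takes place on the universal cover ℝ × ℝ², with data periodic in θ.

Two positive contact forms α₀, α₁ that agree at every point of S¹ have contactomorphic germs
(`kernelRel_of_eqOn_line`), by the Gray–Moser argument. For a fixed value a of the form, a ∧ dα is
affine in dα; hence along S¹ the segment α_t from α₀ to α₁ is contact, and by compactness it is
contact on a tube. The equation i_X dα_t + α̇_t = h α_t with X in ker α_t is solved by a multiple of
the vector dual to α_t ∧ (α₁ - α₀). This X vanishes on S¹, so its flow fixes S¹ pointwise, and it
carries ker α₀ to ker α₁.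

The hypothesis is needed only to arrange agreement along S¹, that is, to find Φ fixing S¹ with m
Φ^*α₂ = α₁ there (`kernelRel_of_tangential`). On ∂_θ this is the hypothesis. Put a = α₁(∂_θ), let β₁
and β₂ be the transverse parts of α₁ and m α₂, read as complex functions of θ, and look for Φ(θ, ζ)
= (θ + s·ζ, wζ). With S = s₁ + i s₂ the condition becomes aS + w̄β₂ = β₁, with w nowhere zero. For
every constant κ it is solved by w = (β̄₁β₂ + aκ)/(|β₂|² + a²) and S = (aβ₁ - κ̄β₂)/(|β₂|² + a²).
Where a = 0 the contact condition makes β₁ and β₂ nonzero, so w ≠ 0; elsewhere w ≠ 0 as soon as κ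
lies off the curve -β̄₁β₂/a, which is a null set in the plane. Since w acts complex linearly, Φ
preserves orientation and m Φ^*α₂ is again positive. The sign of m is irrelevant, since α ∧ dα
scales by m².

The flow comes from the integral equation in C([0,1], E), where composition with a smooth map is a
smooth operator (`exists_flow`). The contactomorphism on the cover descends to S¹ × ℝ² and is
injective near the compact core. -/

noncomputable section

namespace ContactNbhd

open Set Filter Topology

/-! ### Smoothness of composition operators on spaces of continuous maps -/

section CompositionOperator

set_option synthInstance.maxHeartbeats 400000

variable {K : Type} [TopologicalSpace K] [CompactSpace K]
  {F G : Type} [NormedAddCommGroup F] [NormedSpace ℝ F] [NormedAddCommGroup G] [NormedSpace ℝ G]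

/-- Pointwise application of a continuous family of continuous linear maps. -/
def applyPath (A : C(K, F →L[ℝ] G)) (h : C(K, F)) : C(K, G) :=
  ⟨fun t => A t (h t), A.continuous.clm_apply h.continuous⟩

theorem norm_applyPath_le (A : C(K, F →L[ℝ] G)) (h : C(K, F)) :
    ‖applyPath A h‖ ≤ ‖A‖ * ‖h‖ := by
  rw [ContinuousMap.norm_le _ (mul_nonneg (norm_nonneg A) (norm_nonneg h))]
  intro t
  exact (ContinuousLinearMap.le_opNorm (A t) (h t)).trans
    (mul_le_mul (A.norm_coe_le_norm t) (h.norm_coe_le_norm t) (norm_nonneg _) (norm_nonneg _))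

/-- Pointwise application, as a bilinear map. -/
def applyPathBilin : C(K, F →L[ℝ] G) →ₗ[ℝ] C(K, F) →ₗ[ℝ] C(K, G) :=
  LinearMap.mk₂ ℝ applyPath (fun _ _ _ => ContinuousMap.ext fun _ => rfl)
    (fun _ _ _ => ContinuousMap.ext fun _ => rfl)
    (fun A _ _ => ContinuousMap.ext fun t => (A t).map_add _ _)
    (fun c A _ => ContinuousMap.ext fun t => (A t).map_smul c _)

theorem norm_applyPathBilin_le (A : C(K, F →L[ℝ] G)) (h : C(K, F)) :
    ‖applyPathBilin A h‖ ≤ 1 * ‖A‖ * ‖h‖ :=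
  (norm_applyPath_le A h).trans_eq (by rw [one_mul])

/-- Pointwise application, as a continuous bilinear map. -/
def pointwiseApply : C(K, F →L[ℝ] G) →L[ℝ] C(K, F) →L[ℝ] C(K, G) :=
  LinearMap.mkContinuous₂ (E := C(K, F →L[ℝ] G)) (F := C(K, F)) (G := C(K, G))
    (σ₁₃ := RingHom.id ℝ) (σ₂₃ := RingHom.id ℝ) applyPathBilin 1 norm_applyPathBilin_le

theorem norm_pointwiseApply_le (A : C(K, F →L[ℝ] G)) : ‖pointwiseApply A‖ ≤ ‖A‖ :=
  ContinuousLinearMap.opNorm_le_bound _ (norm_nonneg A) (norm_applyPath_le A)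

/-- The composition operator `g ↦ X ∘ g` on continuous maps is differentiable. -/
theorem hasFDerivAt_postcomp {X : F → G} {X' : F → F →L[ℝ] G} (hX : Continuous X)
    (hX' : Continuous X') (hd : ∀ x, HasFDerivAt X (X' x) x) (g : C(K, F)) :
    HasFDerivAt (fun g : C(K, F) => (⟨X, hX⟩ : C(F, G)).comp g)
      (pointwiseApply ((⟨X', hX'⟩ : C(F, F →L[ℝ] G)).comp g)) g := by
  rw [hasFDerivAt_iff_isLittleO_nhds_zero, Asymptotics.isLittleO_iff]
  intro ε hε
  have hc : Continuous fun g : C(K, F) => (⟨X', hX'⟩ : C(F, F →L[ℝ] G)).comp g :=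
    ContinuousMap.continuous_postcomp _
  -- Continuity of `g ↦ X' ∘ g` in the sup norm supplies one δ for all points t of K, so the mean
  -- value inequality below is uniform in t.
  obtain ⟨δ, hδ, H⟩ := Metric.continuous_iff (α := C(K, F)) (β := C(K, F →L[ℝ] G)) |>.1 hc g ε hε
  filter_upwards [Metric.ball_mem_nhds (0 : C(K, F)) hδ] with h hh
  rw [ContinuousMap.norm_le _ (by positivity)]
  intro t
  have hht : ‖h t‖ < δ := (h.norm_coe_le_norm t).trans_lt (by simpa using hh)
  have key := (convex_ball (g t) δ).norm_image_sub_le_of_norm_hasFDerivWithin_le'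
    (f := X) (f' := X') (φ := X' (g t)) (C := ε) (x := g t) (y := g t + h t)
    (fun x _ => (hd x).hasFDerivWithinAt) ?_ (Metric.mem_ball_self hδ) (by simpa using hht)
  · simp only [add_sub_cancel_left] at key
    refine le_trans ?_ (key.trans (mul_le_mul_of_nonneg_left (h.norm_coe_le_norm t) hε.le))
    exact le_of_eq rfl
  · intro x hx
    -- The test map is g translated by a constant so that it takes the value x at t; it lies within
    -- δ of g.
    have h1 : dist (g + ContinuousMap.const K (x - g t)) g < δ := by
      rw [dist_eq_norm, add_sub_cancel_left]
      refine lt_of_le_of_lt ?_ (mem_ball_iff_norm.1 hx)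
      exact (ContinuousMap.norm_le _ (norm_nonneg _)).2 fun _ => le_rfl
    have h2 := (ContinuousMap.norm_coe_le_norm _ t).trans_lt
      ((dist_eq_norm _ _).symm.trans_lt (H _ h1))
    have h3 : g t + (x - g t) = x := by abel
    simpa [h3] using h2.le

/-- The derivative of composition with X is composition with `fderiv ℝ X`, followed by a continuous
linear map. The induction therefore changes the target, which is why G is generalized. -/
theorem contDiff_nat_postcomp (n : ℕ) {G : Type} [NormedAddCommGroup G] [NormedSpace ℝ G]
    {X : F → G} (hc : Continuous X) (hX : ContDiff ℝ ∞ X) :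
    ContDiff ℝ n (fun g : C(K, F) => (⟨X, hc⟩ : C(F, G)).comp g) := by
  induction n generalizing G with
  | zero => exact contDiff_zero.2 (ContinuousMap.continuous_postcomp _)
  | succ n ih =>
    have h' : ContDiff ℝ ∞ (fderiv ℝ X) := hX.fderiv_right (by simp)
    rw [Nat.cast_succ, contDiff_succ_iff_hasFDerivAt]
    exact ⟨_, pointwiseApply.contDiff.comp (ih h'.continuous h'),
      hasFDerivAt_postcomp hc h'.continuous
        fun x => (hX.differentiable (by simp) x).hasFDerivAt⟩

theorem contDiff_postcomp {X : F → G} (hc : Continuous X) (hX : ContDiff ℝ ∞ X) :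
    ContDiff ℝ ∞ (fun g : C(K, F) => (⟨X, hc⟩ : C(F, G)).comp g) :=
  contDiff_infty.2 fun n => contDiff_nat_postcomp n hc hX

end CompositionOperator

/-! ### Flows of slowly varying vector fields -/

section Flow

set_option synthInstance.maxHeartbeats 400000

open unitInterval

variable {E : Type} [NormedAddCommGroup E]

theorem intervalIntegrable_extend (ζ : C(I, E)) (a b : ℝ) :
    IntervalIntegrable (fun τ => ζ (projIcc 0 1 zero_le_one τ)) MeasureTheory.volume a b :=
  (ζ.continuous.comp continuous_projIcc).intervalIntegrable _ _

variable [NormedSpace ℝ E]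

/-- The primitive, vanishing at `0`, of a continuous function on the unit interval. -/
def primitive : C(I, E) →L[ℝ] C(I, E) :=
  LinearMap.mkContinuous
    { toFun := fun ζ => ⟨fun t => ∫ τ in (0 : ℝ)..t, ζ (projIcc 0 1 zero_le_one τ),
        (intervalIntegral.continuous_primitive (intervalIntegrable_extend ζ) 0).comp
          continuous_subtype_val⟩
      map_add' := fun ζ η => by
        ext t
        exact intervalIntegral.integral_add (intervalIntegrable_extend ζ 0 t)
          (intervalIntegrable_extend η 0 t)
      map_smul' := fun c ζ => by
        ext t
        exact intervalIntegral.integral_smul c _ } 1 (by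
    intro ζ
    rw [one_mul, ContinuousMap.norm_le _ (norm_nonneg _)]
    intro t
    refine (intervalIntegral.norm_integral_le_of_norm_le_const (C := ‖ζ‖)
      fun τ _ => ζ.norm_coe_le_norm _).trans ?_
    rw [sub_zero, abs_of_nonneg t.2.1]
    exact mul_le_of_le_one_right (norm_nonneg _) t.2.2)

theorem primitive_apply (ζ : C(I, E)) (t : I) :
    primitive ζ t = ∫ τ in (0 : ℝ)..t, ζ (projIcc 0 1 zero_le_one τ) := rfl

@[simp] theorem primitive_zero (ζ : C(I, E)) : primitive ζ 0 = 0 := by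
  simp [primitive_apply]

theorem norm_primitive_le (ζ : C(I, E)) : ‖primitive ζ‖ ≤ ‖ζ‖ := by
  simpa using (primitive (E := E)).le_of_opNorm_le
    (LinearMap.mkContinuous_norm_le _ zero_le_one _) ζ

theorem hasDerivWithinAt_primitive [CompleteSpace E] (ζ : C(I, E)) (t : I) :
    HasDerivWithinAt (fun s => primitive ζ (projIcc 0 1 zero_le_one s)) (ζ t) (Icc 0 1) t := by
  have hc : Continuous fun τ => ζ (projIcc 0 1 zero_le_one τ) :=
    ζ.continuous.comp continuous_projIcc
  have h := (intervalIntegral.integral_hasDerivAt_right (hc.intervalIntegrable 0 t)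
    (hc.stronglyMeasurableAtFilter _ _) hc.continuousAt).hasDerivWithinAt (s := Icc (0 : ℝ) 1)
  rw [projIcc_val] at h
  refine h.congr (fun s hs => ?_) ?_
  · rw [primitive_apply, projIcc_of_mem zero_le_one hs]
  · rw [projIcc_val, primitive_apply]

/-- The graph of a path, as a path in space-time. -/
def graphMap : C(I, E) → C(I, ℝ × E) :=
  fun γ => ⟨fun t => ((t : ℝ), γ t), by fun_prop⟩

def sndInclusion : C(I, E) →L[ℝ] C(I, ℝ × E) :=
  (ContinuousLinearMap.inr ℝ ℝ E).compLeftContinuous ℝ I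

theorem contDiff_graphMap : ContDiff ℝ ∞ (graphMap (E := E)) ∧
    ∀ γ, HasFDerivAt (graphMap (E := E)) sndInclusion γ := by
  have : graphMap (E := E) = fun γ => graphMap 0 + sndInclusion γ := by
    ext γ t <;> simp [graphMap, sndInclusion]
  rw [this]
  exact ⟨contDiff_const.add (sndInclusion (E := E)).contDiff,
    fun γ => (sndInclusion (E := E)).hasFDerivAt.const_add _⟩

/-- A time-dependent vector field along a path. -/
def alongPath (X : ℝ × E → E) (hX : Continuous X) (γ : C(I, E)) : C(I, E) :=
  (⟨X, hX⟩ : C(ℝ × E, E)).comp (graphMap γ)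

/-- The spatial derivative of a time-dependent vector field. -/
def spaceDeriv (X : ℝ × E → E) (q : ℝ × E) : E →L[ℝ] E :=
  (fderiv ℝ X q).comp (ContinuousLinearMap.inr ℝ ℝ E)

theorem continuous_spaceDeriv {X : ℝ × E → E} (hX : ContDiff ℝ ∞ X) :
    Continuous (spaceDeriv X) :=
  (hX.continuous_fderiv (by simp)).clm_comp continuous_const

theorem hasFDerivAt_alongPath {X : ℝ × E → E} (hX : ContDiff ℝ ∞ X) (γ : C(I, E)) :
    HasFDerivAt (alongPath X hX.continuous)
      (pointwiseApply ((⟨spaceDeriv X, continuous_spaceDeriv hX⟩ : C(ℝ × E, E →L[ℝ] E)).comp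
        (graphMap γ))) γ :=
  ((hasFDerivAt_postcomp hX.continuous (hX.continuous_fderiv (by simp))
    (fun x => (hX.differentiable (by simp) x).hasFDerivAt) (graphMap γ)).comp γ
      (contDiff_graphMap.2 γ)).congr_fderiv
    (ContinuousLinearMap.ext fun _ => ContinuousMap.ext fun _ => rfl)

theorem contDiff_alongPath {X : ℝ × E → E} (hX : ContDiff ℝ ∞ X) :
    ContDiff ℝ ∞ (alongPath X hX.continuous) :=
  (contDiff_postcomp hX.continuous hX).comp contDiff_graphMap.1

/-- If `T` is smooth with derivative of norm at most `1/4`, then `id - T` is a diffeomorphism. -/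
theorem exists_inverse_id_sub {B : Type} [NormedAddCommGroup B] [NormedSpace ℝ B] [CompleteSpace B]
    {T : B → B} {T' : B → B →L[ℝ] B} (hT : ContDiff ℝ ∞ T) (hd : ∀ x, HasFDerivAt T (T' x) x)
    (hb : ∀ x, ‖T' x‖ ≤ 1 / 4) :
    ∃ S : B → B, ContDiff ℝ ∞ S ∧ (∀ x, S x - T (S x) = x) ∧ ∀ x, S (x - T x) = x := by
  have hlip : ∀ x y, ‖T x - T y‖ ≤ 1 / 4 * ‖x - y‖ := fun x y =>
    convex_univ.norm_image_sub_le_of_norm_hasFDerivWithin_le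
      (fun x _ => (hd x).hasFDerivWithinAt) (fun x _ => hb x) (mem_univ y) (mem_univ x)
  have happ : ApproximatesLinearOn (fun x => x - T x)
      ((ContinuousLinearEquiv.refl ℝ B : B ≃L[ℝ] B) : B →L[ℝ] B) univ (1 / 4) := by
    intro x _ y _
    have : (x - T x) - (y - T y) - (x - y) = -(T x - T y) := by abel
    simpa [this, norm_sub_rev] using hlip x y
  have hc : Subsingleton B ∨ (1 / 4 : NNReal) <
      ‖((ContinuousLinearEquiv.refl ℝ B).symm : B →L[ℝ] B)‖₊⁻¹ := by
    rcases subsingleton_or_nontrivial B with h | h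
    · exact Or.inl h
    · right
      have : ‖((ContinuousLinearEquiv.refl ℝ B).symm : B →L[ℝ] B)‖₊ = 1 := by
        ext
        exact ContinuousLinearMap.norm_id
      rw [this, inv_one]
      rw [← NNReal.coe_lt_coe]
      norm_num
  let Ψ : B ≃ₜ B := happ.toHomeomorph _ hc
  -- The derivative id - T' is invertible by the Neumann series, so the inverse homeomorphism is
  -- smooth.
  have hlt : ∀ x, ‖T' x‖ < 1 := fun x => (hb x).trans_lt (by norm_num)
  refine ⟨Ψ.symm, Ψ.contDiff_symm
    (f₀' := fun x => ContinuousLinearEquiv.ofUnit (Units.oneSub (T' x) (hlt x)))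
    (fun x => ?_) (contDiff_id.sub hT), Ψ.apply_symm_apply, Ψ.symm_apply_apply⟩
  exact (hasFDerivAt_id x).sub (hd x)

theorem norm_primitive_comp_le {X : ℝ × E → E} (hX : ContDiff ℝ ∞ X)
    (hK : ∀ t ∈ Icc (0 : ℝ) 1, ∀ x, ‖spaceDeriv X (t, x)‖ ≤ 1 / 4) (γ : C(I, E)) :
    ‖primitive.comp (pointwiseApply
      ((⟨spaceDeriv X, continuous_spaceDeriv hX⟩ : C(ℝ × E, E →L[ℝ] E)).comp (graphMap γ)))‖
      ≤ 1 / 4 := by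
  refine ContinuousLinearMap.opNorm_le_bound _ (by norm_num) fun h => ?_
  refine (norm_primitive_le _).trans ?_
  refine (ContinuousLinearMap.le_opNorm _ _).trans ?_
  refine mul_le_mul_of_nonneg_right ?_ (norm_nonneg _)
  refine (norm_pointwiseApply_le _).trans ?_
  rw [ContinuousMap.norm_le _ (by norm_num)]
  exact fun t => hK t t.2 _

/-- Solutions of an ordinary differential equation with a slowly varying right-hand side exist on
the unit interval, are unique and depend smoothly on the initial value. -/
theorem exists_flow [CompleteSpace E] {X : ℝ × E → E} (hX : ContDiff ℝ ∞ X)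
    (hK : ∀ t ∈ Icc (0 : ℝ) 1, ∀ x, ‖spaceDeriv X (t, x)‖ ≤ 1 / 4) :
    ∃ Γ : E → C(I, E), ContDiff ℝ ∞ Γ ∧
      (∀ p, Γ p = ContinuousMap.const I p + primitive (alongPath X hX.continuous (Γ p))) ∧
      (∀ p γ, γ = ContinuousMap.const I p + primitive (alongPath X hX.continuous γ) → γ = Γ p) ∧
      ∀ p v, fderiv ℝ Γ p v = ContinuousMap.const I v + primitive (pointwiseApply
        ((⟨spaceDeriv X, continuous_spaceDeriv hX⟩ : C(ℝ × E, E →L[ℝ] E)).comp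
          (graphMap (Γ p))) (fderiv ℝ Γ p v)) := by
  have hT : ContDiff ℝ ∞ fun γ : C(I, E) => primitive (alongPath X hX.continuous γ) :=
    (primitive (E := E)).contDiff.comp (contDiff_alongPath hX)
  have hd := fun γ : C(I, E) => (primitive (E := E)).hasFDerivAt.comp γ (hasFDerivAt_alongPath hX γ)
  obtain ⟨S, hS, hS1, hS2⟩ := exists_inverse_id_sub hT hd (norm_primitive_comp_le hX hK)
  let c : E →L[ℝ] C(I, E) := ContinuousLinearMap.const ℝ I
  have hΓ : ContDiff ℝ ∞ fun p => S (c p) := hS.comp c.contDiff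
  have h1 : ∀ p, S (c p) = c p + primitive (alongPath X hX.continuous (S (c p))) :=
    fun p => eq_add_of_sub_eq (hS1 (c p))
  refine ⟨fun p => S (c p), hΓ, h1, fun p γ hγ => ?_, fun p v => ?_⟩
  · rw [← hS2 γ]
    congr 1
    exact sub_eq_of_eq_add hγ
  · have hdΓ := (hΓ.differentiable (by simp) p).hasFDerivAt
    have h2 := (c.hasFDerivAt (x := p)).add ((hd (S (c p))).comp p hdΓ)
    -- The integral equation holds identically in p; differentiating both sides gives the
    -- variational equation.
    have h4 := hdΓ.unique (h2.congr_of_eventuallyEq (Eventually.of_forall h1))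
    exact DFunLike.congr_fun h4 v

end Flow

/-! ### Exterior algebra of 1-forms on the cover -/

section Forms

/-- The zero section of the cover, i.e. the universal cover of the core circle. -/
def line : Set Cover := {z | z.2 = 0}

/-- The generator of the deck group of the cover. -/
def period : Cover := (2 * Real.pi, 0)

theorem eq_sum_coords (w : Cover) : w = w.1 • eθ + w.2 0 • eX + w.2 1 • eY := by
  ext i
  · simp [eθ, eX, eY]
  · fin_cases i <;> simp [eθ, eX, eY]

/-- The function `a ∧ dA` on the standard basis, in terms of the values `a` and `D` of a 1-form
and of its derivative. -/
def wedgeAlg (a : Cover →L[ℝ] ℝ) (D : Cover →L[ℝ] Cover →L[ℝ] ℝ) : ℝ :=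
  a eθ * (D eX eY - D eY eX) + a eX * (D eY eθ - D eθ eY) + a eY * (D eθ eX - D eX eθ)

theorem extDerivOne_eq {A : Cover → Cover →L[ℝ] ℝ} {z : Cover} (hA : DifferentiableAt ℝ A z)
    (v w : Cover) : extDerivOne A z v w = fderiv ℝ A z v w - fderiv ℝ A z w v := by
  let e : (Cover →L[ℝ] ℝ) →L[ℝ] (Cover [⋀^Fin 1]→L[ℝ] ℝ) :=
    (ContinuousAlternatingMap.ofSubsingletonLIE (𝕜 := ℝ) (E := Cover) (F := ℝ)
      (0 : Fin 1)).toContinuousLinearEquiv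
  have h : DifferentiableAt ℝ
      (fun q => ContinuousAlternatingMap.ofSubsingleton ℝ Cover ℝ (0 : Fin 1) (A q)) z :=
    e.differentiableAt.comp z hA
  have h1 : ∀ v w, fderiv ℝ (fun q => A q w) z v = fderiv ℝ A z v w := fun v w => by
    simp [fderiv_clm_apply hA (differentiableAt_const w)]
  rw [extDerivOne, extDeriv_apply h]
  simp [Fin.sum_univ_succ, Fin.removeNth, h1, sub_eq_add_neg]

theorem wedgeExtDeriv_eq {A : Cover → Cover →L[ℝ] ℝ} {z : Cover} (hA : DifferentiableAt ℝ A z) :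
    wedgeExtDeriv A z eθ eX eY = wedgeAlg (A z) (fderiv ℝ A z) := by
  simp only [wedgeExtDeriv, wedgeAlg, extDerivOne_eq hA]

/-- The vector dual to the 2-form `a ∧ b` with respect to the standard volume form. -/
def cross (a b : Cover →L[ℝ] ℝ) : Cover :=
  (a eX * b eY - a eY * b eX) • eθ + (a eY * b eθ - a eθ * b eY) • eX +
    (a eθ * b eX - a eX * b eθ) • eY

theorem apply_cross_self (a b : Cover →L[ℝ] ℝ) : a (cross a b) = 0 := by
  simp only [cross, map_add, map_smul, smul_eq_mul]
  ring

/-- The algebraic identity behind Gray's stability theorem in dimension three. -/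
theorem cross_identity (a b : Cover →L[ℝ] ℝ) (D : Cover →L[ℝ] Cover →L[ℝ] ℝ) (w : Cover) :
    D (cross a b) w - D w (cross a b) + wedgeAlg a D * b w = wedgeAlg b D * a w := by
  rw [eq_sum_coords w]
  simp only [cross, wedgeAlg, map_add, map_smul, smul_eq_mul, add_apply,
    smul_apply]
  ring

end Forms

/-! ### Germs of periodic contactomorphisms along the line -/

section KernelRel

/-- The planes `ker A` and `ker B` are related by the germ along the line of a periodic
diffeomorphism that fixes the line pointwise. -/
def KernelRel (A B : Cover → Cover →L[ℝ] ℝ) : Prop :=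
  ∃ F : Cover → Cover, (∀ z, F (z + period) = F z + period) ∧ (∀ z ∈ line, F z = z) ∧
    ∀ᶠ z in 𝓝ˢ line, ContDiffAt ℝ ∞ F z ∧ (fderiv ℝ F z).IsInvertible ∧
      ∀ v, A z v = 0 ↔ B (F z) (fderiv ℝ F z v) = 0

theorem KernelRel.refl (A : Cover → Cover →L[ℝ] ℝ) : KernelRel A A :=
  ⟨id, fun _ => rfl, fun _ _ => rfl, Eventually.of_forall fun z => ⟨contDiffAt_id, by
    rw [fderiv_id]; exact ⟨ContinuousLinearEquiv.refl ℝ _, rfl⟩, fun v => by simp⟩⟩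

theorem KernelRel.trans {A B C : Cover → Cover →L[ℝ] ℝ} (hAB : KernelRel A B)
    (hBC : KernelRel B C) : KernelRel A C := by
  obtain ⟨F, hF1, hF2, hF3⟩ := hAB
  obtain ⟨G, hG1, hG2, hG3⟩ := hBC
  have ht : Tendsto F (𝓝ˢ line) (𝓝ˢ line) := by
    rw [tendsto_iff_eventually]
    intro P hP
    rw [eventually_nhdsSet_iff_forall] at hP hF3 ⊢
    intro z hz
    have := (hF3 z hz).self_of_nhds.1.continuousAt
    rw [ContinuousAt, hF2 z hz] at this
    exact this.eventually (hP z hz)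
  refine ⟨G ∘ F, fun z => by simp [hF1, hG1], fun z hz => by simp [hF2 z hz, hG2 z hz], ?_⟩
  filter_upwards [hF3, ht.eventually hG3] with z ⟨h1, h2, h3⟩ ⟨k1, k2, k3⟩
  have hc : fderiv ℝ (G ∘ F) z = (fderiv ℝ G (F z)).comp (fderiv ℝ F z) :=
    fderiv_comp z (k1.differentiableAt (by simp)) (h1.differentiableAt (by simp))
  refine ⟨k1.comp z h1, ?_, fun v => ?_⟩
  · rw [hc]
    exact k2.comp h2
  · rw [hc, h3, k3]
    rfl

end KernelRel

/-! ### Gray's stability theorem -/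

section Gray

open unitInterval

/-- A solution on `[0, 1]` of a linear homogeneous scalar equation vanishes at `0` if and only if it
vanishes at `1`. -/
theorem eq_zero_iff_of_linear_ode {u h : ℝ → ℝ} (hh : ContinuousOn h (Icc 0 1))
    (hu : ∀ t ∈ Icc (0 : ℝ) 1, HasDerivWithinAt u (h t * u t) (Icc 0 1) t) :
    u 0 = 0 ↔ u 1 = 0 := by
  have hH : Continuous (IccExtend (zero_le_one' ℝ) ((Icc (0 : ℝ) 1).domRestrict h)) :=
    (continuousOn_iff_continuous_domRestrict.1 hh).Icc_extend'
  set H := IccExtend (zero_le_one' ℝ) ((Icc (0 : ℝ) 1).domRestrict h)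
  have hHh : ∀ t ∈ Icc (0 : ℝ) 1, H t = h t := fun t ht => IccExtend_of_mem _ _ ht
  set P : ℝ → ℝ := fun t => ∫ s in (0 : ℝ)..t, H s
  have hP : ∀ t, HasDerivAt P (H t) t := fun t =>
    intervalIntegral.integral_hasDerivAt_right (hH.intervalIntegrable 0 t)
      (hH.stronglyMeasurableAtFilter _ _) hH.continuousAt
  have hg : ∀ t ∈ Icc (0 : ℝ) 1,
      HasDerivWithinAt (fun t => Real.exp (-P t) * u t) 0 (Icc 0 1) t := by
    intro t ht
    have := ((hP t).neg.exp.hasDerivWithinAt (s := Icc 0 1)).mul (hu t ht)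
    refine this.congr_deriv ?_
    rw [hHh t ht]
    ring
  have hc := constant_of_derivWithin_zero (fun t ht => (hg t ht).differentiableWithinAt)
    (fun t ht => (hg t ⟨ht.1, ht.2.le⟩).derivWithin
      (uniqueDiffOn_Icc zero_lt_one t ⟨ht.1, ht.2.le⟩)) 1 ⟨zero_le_one, le_rfl⟩
  have h0 := Real.exp_ne_zero (-P 0)
  have h1 := Real.exp_ne_zero (-P 1)
  constructor
  · intro h
    simpa [h, h1] using hc
  · intro h
    have := hc.symm
    simpa [h, h0] using this

variable {X : ℝ × Cover → Cover} {B : ℝ × Cover → Cover →L[ℝ] ℝ} {h : ℝ × Cover → ℝ} {U : Set Cover}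

/-- The equation of Gray's stability theorem: the derivative of the path `B` of 1-forms along the
time-dependent vector field `X`, which is tangent to `ker B`, is the multiple `h • B` of `B`. -/
structure IsGrayField (X : ℝ × Cover → Cover) (B : ℝ × Cover → Cover →L[ℝ] ℝ) (h : ℝ × Cover → ℝ)
    (U : Set Cover) : Prop where
  smooth : ContDiff ℝ ∞ X
  periodic : ∀ t z, X (t, z + period) = X (t, z)
  eq_zero : ∀ t, ∀ z ∈ line, X (t, z) = 0
  isOpen : IsOpen U
  line_subset : line ⊆ U
  differentiableAt : ∀ t, ∀ z ∈ U, DifferentiableAt ℝ B (t, z)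
  continuousOn : ContinuousOn h (univ ×ˢ U)
  tangent : ∀ t, ∀ z ∈ U, B (t, z) (X (t, z)) = 0
  gray : ∀ t, ∀ z ∈ U, ∀ w, fderiv ℝ B (t, z) (1, X (t, z)) w -
    fderiv ℝ B (t, z) (0, w) (X (t, z)) = h (t, z) * B (t, z) w

/-- Differentiating the identity B(X) = 0 in the spatial direction w replaces B(∂_w X) by -(∂_w
B)(X). The derivative of B(w) along the linearized flow is then the left side of `gray`, so B(w)
solves a scalar linear equation and its vanishing is preserved in time. -/
theorem IsGrayField.hasDerivWithinAt (H : IsGrayField X B h U) {γ w : ℝ → Cover} {t : ℝ}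
    (hγU : γ t ∈ U)
    (hγ : HasDerivWithinAt γ (X (t, γ t)) (Icc 0 1) t)
    (hw : HasDerivWithinAt w (spaceDeriv X (t, γ t) (w t)) (Icc 0 1) t) :
    HasDerivWithinAt (fun t => B (t, γ t) (w t)) (h (t, γ t) * B (t, γ t) (w t)) (Icc 0 1) t := by
  have hB := (H.differentiableAt t _ hγU).hasFDerivAt
  have hX := (H.smooth.differentiable (by simp) (t, γ t)).hasFDerivAt
  have hq : HasDerivWithinAt (fun t => (t, γ t)) (1, X (t, γ t)) (Icc 0 1) t :=
    (hasDerivWithinAt_id t _).prodMk hγ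
  have hBq := hB.comp_hasDerivWithinAt t hq
  have h1 := hBq.clm_apply hw
  refine h1.congr_deriv ?_
  rw [← H.gray t _ hγU]
  have hi : HasFDerivAt (fun z : Cover => (t, z)) (ContinuousLinearMap.inr ℝ ℝ Cover) (γ t) :=
    hasFDerivAt_prodMk_right t (γ t)
  have h2 := (hB.comp (γ t) hi).clm_apply (hX.comp (γ t) hi)
  have h3 : (fun z => (B ∘ fun z => (t, z)) z ((X ∘ fun z => (t, z)) z)) =ᶠ[𝓝 (γ t)]
      fun _ => (0 : ℝ) := by
    filter_upwards [H.isOpen.mem_nhds hγU] with z hz using H.tangent t z hz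
  have h4 := DFunLike.congr_fun (h2.unique ((hasFDerivAt_const (0 : ℝ) _).congr_of_eventuallyEq h3))
    (w t)
  simp [spaceDeriv] at h4 ⊢
  linarith

/-- One time step of Gray's argument, for a slowly varying vector field. -/
theorem IsGrayField.kernelRel_of_small (H : IsGrayField X B h U)
    (hK : ∀ t ∈ Icc (0 : ℝ) 1, ∀ x, ‖spaceDeriv X (t, x)‖ ≤ 1 / 4) :
    KernelRel (fun z => B (0, z)) (fun z => B (1, z)) := by
  obtain ⟨Γ, hΓ, hsol, huniq, hvar⟩ := exists_flow H.smooth hK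
  have hev : ∀ t : I, ContDiff ℝ ∞ fun p => Γ p t := fun t =>
    (ContinuousMap.evalCLM ℝ t : C(I, Cover) →L[ℝ] Cover).contDiff.comp hΓ
  have hdev : ∀ p v (t : I), fderiv ℝ (fun p => Γ p t) p v = fderiv ℝ Γ p v t := fun p v t =>
    DFunLike.congr_fun (((ContinuousMap.evalCLM ℝ t : C(I, Cover) →L[ℝ] Cover).hasFDerivAt.comp p
      (hΓ.differentiable (by simp) p).hasFDerivAt).fderiv) v
  have hline : ∀ z ∈ line, Γ z = ContinuousMap.const I z := by
    intro z hz
    refine (huniq z _ ?_).symm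
    have : alongPath X H.smooth.continuous (ContinuousMap.const I z) = 0 := by
      ext1 t
      exact H.eq_zero _ _ hz
    rw [this, map_zero, add_zero]
  refine ⟨fun p => Γ p 1, fun z => ?_, fun z hz => DFunLike.congr_fun (hline z hz) 1, ?_⟩
  -- A solution translated by a period is again a solution, so uniqueness gives equivariance.
  · have : Γ z + ContinuousMap.const I period = Γ (z + period) := by
      refine huniq _ _ ?_
      have h1 : alongPath X H.smooth.continuous (Γ z + ContinuousMap.const I period) =
          alongPath X H.smooth.continuous (Γ z) := by
        ext1 t
        exact H.periodic _ _
      rw [h1]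
      conv_lhs => rw [hsol z]
      ext1 t
      simp only [ContinuousMap.add_apply, ContinuousMap.const_apply]
      abel
    exact (DFunLike.congr_fun this 1).symm
  · rw [eventually_nhdsSet_iff_forall]
    intro z₀ hz₀
    -- The Gray equation holds only on U. The trajectory of z₀ is constant, so nearby trajectories
    -- stay in U during all of [0, 1].
    have hopen : ∀ᶠ p in 𝓝 z₀, ∀ t, Γ p t ∈ U := by
      have h1 : {γ : C(I, Cover) | MapsTo γ univ U} ∈ 𝓝 (Γ z₀) := by
        refine (ContinuousMap.isOpen_setOfPred_mapsTo isCompact_univ H.isOpen).mem_nhds fun t _ => ?_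
        rw [hline z₀ hz₀]
        exact H.line_subset hz₀
      filter_upwards [hΓ.continuous.continuousAt.preimage_mem_nhds h1] with p hp t
        using hp (mem_univ t)
    filter_upwards [hopen] with p hp
    refine ⟨(hev 1).contDiffAt, ?_, fun v => ?_⟩
    -- From ‖W - v‖ ≤ ‖W‖/4 ≤ (‖W - v‖ + ‖v‖)/4 follows ‖W - v‖ ≤ ‖v‖/3, which makes the derivative
    -- invertible.
    · have hsmall : ∀ v, ‖fderiv ℝ (fun p => Γ p 1) p v - v‖ ≤ 1 / 3 * ‖v‖ := by
        intro v
        have h1 := hvar p v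
        have hb := (primitive.comp (pointwiseApply ((⟨spaceDeriv X,
          continuous_spaceDeriv H.smooth⟩ : C(ℝ × Cover, Cover →L[ℝ] Cover)).comp
            (graphMap (Γ p))))).le_of_opNorm_le (norm_primitive_comp_le H.smooth hK (Γ p))
            (fderiv ℝ Γ p v)
        set W := fderiv ℝ Γ p v
        have hcv : ‖ContinuousMap.const I v‖ ≤ ‖v‖ :=
          (ContinuousMap.norm_le _ (norm_nonneg _)).2 fun _ => le_rfl
        have h2 : W - ContinuousMap.const I v = (primitive.comp (pointwiseApply ((⟨spaceDeriv X,
          continuous_spaceDeriv H.smooth⟩ : C(ℝ × Cover, Cover →L[ℝ] Cover)).comp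
            (graphMap (Γ p))))) W := sub_eq_of_eq_add' h1
        rw [← h2] at hb
        have h3 : ‖W‖ ≤ ‖W - ContinuousMap.const I v‖ + ‖ContinuousMap.const I v‖ := by
          simpa using norm_add_le (W - ContinuousMap.const I v) (ContinuousMap.const I v)
        have h4 := (W - ContinuousMap.const I v).norm_coe_le_norm 1
        rw [hdev]
        refine h4.trans ?_
        linarith
      have hn : ‖ContinuousLinearMap.id ℝ Cover - fderiv ℝ (fun p => Γ p 1) p‖ < 1 := by
        refine (ContinuousLinearMap.opNorm_le_bound _ (by norm_num : (0 : ℝ) ≤ 1 / 3)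
          fun v => ?_).trans_lt (by norm_num)
        rw [sub_apply, norm_sub_rev]
        exact hsmall v
      refine ⟨ContinuousLinearEquiv.ofUnit (Units.oneSub _ hn), ?_⟩
      exact sub_sub_cancel (ContinuousLinearMap.id ℝ Cover) _
    · have hext : ∀ (γ : C(I, Cover)) (t : ℝ) (ht : t ∈ Icc (0 : ℝ) 1),
          γ (projIcc 0 1 zero_le_one t) = γ ⟨t, ht⟩ := fun γ t ht => by
        rw [projIcc_of_mem zero_le_one ht]
      set W := fderiv ℝ Γ p v with hW
      have key := eq_zero_iff_of_linear_ode
        (u := fun t => B (t, Γ p (projIcc 0 1 zero_le_one t)) (W (projIcc 0 1 zero_le_one t)))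
        (h := fun t => h (t, Γ p (projIcc 0 1 zero_le_one t))) ?_ ?_
      · have h0 : projIcc (0 : ℝ) 1 zero_le_one 0 = 0 := projIcc_left _
        have h1 : projIcc (0 : ℝ) 1 zero_le_one 1 = 1 := projIcc_right _
        have hp0 : Γ p 0 = p := by
          rw [hsol p, ContinuousMap.add_apply, primitive_zero]
          exact add_zero _
        have hW0 : W 0 = v := by
          rw [hW, hvar p v, ContinuousMap.add_apply, primitive_zero]
          exact add_zero _
        rw [hdev]
        simpa only [h0, h1, hp0, hW0] using key
      · refine H.continuousOn.comp (Continuous.continuousOn ?_) fun t _ => ⟨mem_univ _, hp _⟩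
        exact continuous_id.prodMk ((Γ p).continuous.comp continuous_projIcc)
      · intro t ht
        refine H.hasDerivWithinAt (γ := fun t => Γ p (projIcc 0 1 zero_le_one t))
          (w := fun t => W (projIcc 0 1 zero_le_one t)) (hp _) ?_ ?_
        · have h1 := (hasDerivWithinAt_primitive (alongPath X H.smooth.continuous (Γ p))
            ⟨t, ht⟩).const_add p
          have h2 : (fun s => Γ p (projIcc 0 1 zero_le_one s)) = fun s =>
              p + primitive (alongPath X H.smooth.continuous (Γ p)) (projIcc 0 1 zero_le_one s) :=
            funext fun s => DFunLike.congr_fun (hsol p) _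
          rw [h2]
          rw [← h2]
          refine (h2 ▸ h1).congr_deriv ?_
          simp only [hext _ t ht]
          rfl
        · have h1 := (hasDerivWithinAt_primitive (pointwiseApply ((⟨spaceDeriv X,
            continuous_spaceDeriv H.smooth⟩ : C(ℝ × Cover, Cover →L[ℝ] Cover)).comp
            (graphMap (Γ p))) W) ⟨t, ht⟩).const_add v
          have h2 : (fun s => W (projIcc 0 1 zero_le_one s)) = fun s =>
              v + primitive (pointwiseApply ((⟨spaceDeriv X,
            continuous_spaceDeriv H.smooth⟩ : C(ℝ × Cover, Cover →L[ℝ] Cover)).comp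
            (graphMap (Γ p))) W) (projIcc 0 1 zero_le_one s) :=
            funext fun s => DFunLike.congr_fun (hvar p v) _
          refine (h2 ▸ h1).congr_deriv ?_
          simp only [hext _ t ht]
          rfl

/-- Gray's stability theorem along the line. -/
theorem IsGrayField.kernelRel (H : IsGrayField X B h U) {K : ℝ}
    (hK : ∀ t ∈ Icc (0 : ℝ) 1, ∀ x, ‖spaceDeriv X (t, x)‖ ≤ K) :
    KernelRel (fun z => B (0, z)) (fun z => B (1, z)) := by
  -- Cutting [0, 1] into N steps and rescaling time divides the field by N, which brings the bound K
  -- below 1/4; the maximum with 1 keeps N positive.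
  obtain ⟨N, hN⟩ := exists_nat_gt (max 1 (4 * K))
  have hN1 : (1 : ℝ) < N := (le_max_left _ _).trans_lt hN
  have hNK : 4 * K < N := (le_max_right _ _).trans_lt hN
  have hN0 : (0 : ℝ) < N := by linarith
  have step : ∀ i : ℕ, i < N →
      KernelRel (fun z => B ((i : ℝ) / N, z)) (fun z => B (((i + 1 : ℕ) : ℝ) / N, z)) := by
    intro i hi
    have hi' : ((i : ℝ) + 1) ≤ N := by exact_mod_cast hi
    let rsc : ℝ × Cover → ℝ × Cover := fun q => ((i : ℝ) / N + q.1 / N, q.2)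
    let rsc' : ℝ × Cover →L[ℝ] ℝ × Cover :=
      ((N : ℝ)⁻¹ • ContinuousLinearMap.id ℝ ℝ).prodMap (ContinuousLinearMap.id ℝ Cover)
    have hrsc : ContDiff ℝ ∞ rsc := by fun_prop
    have hdrsc : ∀ q, HasFDerivAt rsc rsc' q := by
      intro q
      have : rsc = fun q => ((i : ℝ) / N, (0 : Cover)) + rsc' q := by
        ext1 q
        simp [rsc, rsc', div_eq_inv_mul, Prod.ext_iff]
      rw [this]
      exact rsc'.hasFDerivAt.const_add _
    have hstep : IsGrayField (fun q => (N : ℝ)⁻¹ • X (rsc q)) (fun q => B (rsc q))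
        (fun q => (N : ℝ)⁻¹ * h (rsc q)) U :=
      { smooth := (H.smooth.comp hrsc).const_smul (N : ℝ)⁻¹
        periodic := fun t z => by simp only [rsc, H.periodic]
        eq_zero := fun t z hz => by simp only [rsc, H.eq_zero _ z hz, smul_zero]
        isOpen := H.isOpen
        line_subset := H.line_subset
        differentiableAt := fun t z hz =>
          (H.differentiableAt _ z hz).comp (t, z) (hdrsc _).differentiableAt
        continuousOn := continuousOn_const.mul
          (H.continuousOn.comp hrsc.continuous.continuousOn fun q hq => ⟨mem_univ _, hq.2⟩)
        tangent := fun t z hz => by simp [rsc, H.tangent _ z hz]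
        gray := fun t z hz w => by
          have hd : fderiv ℝ (fun q => B (rsc q)) (t, z) = (fderiv ℝ B (rsc (t, z))).comp rsc' :=
            ((H.differentiableAt _ z hz).hasFDerivAt.comp (t, z) (hdrsc _)).fderiv
          have e1 : rsc' (1, (N : ℝ)⁻¹ • X (rsc (t, z))) = (N : ℝ)⁻¹ • (1, X (rsc (t, z))) := by
            simp [rsc']
          have e2 : rsc' (0, w) = (0, w) := by simp [rsc']
          rw [hd, ContinuousLinearMap.comp_apply, ContinuousLinearMap.comp_apply, e1, e2, map_smul,
            smul_apply, map_smul, smul_eq_mul, smul_eq_mul, ← mul_sub, mul_assoc]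
          rw [show rsc (t, z) = ((i : ℝ) / N + t / N, z) from rfl, H.gray _ z hz w] }
    have := hstep.kernelRel_of_small ?_
    · simpa [rsc, add_div] using this
    · intro t ht x
      have hd : spaceDeriv (fun q => (N : ℝ)⁻¹ • X (rsc q)) (t, x) =
          (N : ℝ)⁻¹ • spaceDeriv X (rsc (t, x)) := by
        have := (((H.smooth.differentiable (by simp) _).hasFDerivAt.comp (t, x)
          (hdrsc (t, x))).const_smul (N : ℝ)⁻¹).fderiv
        refine ContinuousLinearMap.ext fun v => ?_
        have h2 := DFunLike.congr_fun this (0, v)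
        have e2 : rsc' (0, v) = (0, v) := by simp [rsc']
        simp only [smul_apply, ContinuousLinearMap.comp_apply, e2] at h2
        exact h2
      rw [hd, norm_smul, norm_inv, Real.norm_natCast, inv_mul_le_iff₀ hN0]
      have hmem : (i : ℝ) / N + t / N ∈ Icc (0 : ℝ) 1 := by
        have := ht.1
        refine ⟨by positivity, ?_⟩
        rw [← add_div, div_le_one hN0]
        linarith [ht.2]
      refine (hK _ hmem x).trans ?_
      linarith
  have chain : ∀ i : ℕ, i ≤ N → KernelRel (fun z => B (0, z)) (fun z => B ((i : ℝ) / N, z)) := by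
    intro i
    induction i with
    | zero => intro _; simpa using KernelRel.refl _
    | succ i ih => exact fun hi => (ih (Nat.le_of_succ_le hi)).trans (step i hi)
  simpa [div_self hN0.ne'] using chain N le_rfl

end Gray

/-! ### Moser's argument for forms that agree along the line -/

section Moser

theorem exists_mem_Ico_of_periodic {P : Cover → Prop} (hP : ∀ z, P (z + period) ↔ P z) (z : Cover) :
    ∃ θ ∈ Ico 0 (2 * Real.pi), P z ↔ P (θ, z.2) := by
  have hper : Function.Periodic (fun θ => P (θ, z.2)) (2 * Real.pi) := fun θ => by
    have := hP (θ, z.2)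
    simp only [period, Prod.mk_add_mk, add_zero] at this
    exact propext this
  obtain ⟨θ, hθ, h⟩ := hper.exists_mem_Ico₀ Real.two_pi_pos z.1
  exact ⟨θ, hθ, iff_of_eq h⟩

/-- A periodic property that holds near the line holds on a tube of constant radius. -/
theorem exists_tube {P : Cover → Prop} (hP : ∀ z, P (z + period) ↔ P z)
    (h : ∀ᶠ z in 𝓝ˢ line, P z) : ∃ δ > 0, ∀ z : Cover, ‖z.2‖ < δ → P z := by
  have hK : Icc (0 : ℝ) (2 * Real.pi) ×ˢ {(0 : EuclideanSpace ℝ (Fin 2))} ⊆ line :=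
    fun z hz => hz.2
  have h1 := h.filter_mono (nhdsSet_mono hK)
  rw [isCompact_Icc.nhdsSet_prod_eq isCompact_singleton, nhdsSet_singleton,
    eventually_prod_iff] at h1
  obtain ⟨p, hp, q, hq, hpq⟩ := h1
  obtain ⟨δ, hδ, hq⟩ := Metric.eventually_nhds_iff.1 hq
  refine ⟨δ, hδ, fun z hz => ?_⟩
  obtain ⟨θ, hθ, h2⟩ := exists_mem_Ico_of_periodic hP z
  rw [h2]
  exact hpq (hp.self_of_nhdsSet θ ⟨hθ.1, hθ.2.le⟩) (hq (by simpa using hz))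

theorem fderiv_add_period {F : Type*} [NormedAddCommGroup F] [NormedSpace ℝ F] {A : Cover → F}
    (hA : ∀ z, A (z + period) = A z) (z : Cover) : fderiv ℝ A (z + period) = fderiv ℝ A z := by
  rw [← fderiv_comp_add_right, funext hA]

theorem contDiffAt_add_period {F : Type*} [NormedAddCommGroup F] [NormedSpace ℝ F] {A : Cover → F}
    (hA : ∀ z, A (z + period) = A z) (z : Cover) :
    ContDiffAt ℝ ∞ A (z + period) ↔ ContDiffAt ℝ ∞ A z := by
  constructor
  · intro h
    have := h.comp z (contDiffAt_id.add (contDiffAt_const (c := period)))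
    exact this.congr_of_eventuallyEq (Eventually.of_forall fun z => (hA z).symm)
  · intro h
    have h' : ContDiffAt ℝ ∞ A ((z + period) - period) := by rwa [add_sub_cancel_right]
    have := h'.comp (z + period) (contDiffAt_id.sub (contDiffAt_const (c := period)))
    refine this.congr_of_eventuallyEq (Eventually.of_forall fun z => ?_)
    simpa using hA (z - period)

theorem contDiffAt_wedgeAlg {G : Type*} [NormedAddCommGroup G] [NormedSpace ℝ G]
    {a : G → Cover →L[ℝ] ℝ} {D : G → Cover →L[ℝ] Cover →L[ℝ] ℝ} {q : G} {n : WithTop ℕ∞}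
    (ha : ContDiffAt ℝ n a q) (hD : ContDiffAt ℝ n D q) :
    ContDiffAt ℝ n (fun q => wedgeAlg (a q) (D q)) q := by
  unfold wedgeAlg
  fun_prop

theorem contDiffAt_cross {G : Type*} [NormedAddCommGroup G] [NormedSpace ℝ G]
    {a b : G → Cover →L[ℝ] ℝ} {q : G} {n : WithTop ℕ∞}
    (ha : ContDiffAt ℝ n a q) (hb : ContDiffAt ℝ n b q) :
    ContDiffAt ℝ n (fun q => cross (a q) (b q)) q := by
  unfold cross
  fun_prop

/-- On the line all interpolating forms share the value a and only their derivatives vary; linearity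
in the derivative then makes positivity a convex condition. -/
theorem wedgeAlg_convex (a : Cover →L[ℝ] ℝ) (D₀ D₁ : Cover →L[ℝ] Cover →L[ℝ] ℝ) (t : ℝ) :
    wedgeAlg a (D₀ + t • (D₁ - D₀)) = (1 - t) * wedgeAlg a D₀ + t * wedgeAlg a D₁ := by
  simp only [wedgeAlg, add_apply, smul_apply, sub_apply, smul_eq_mul]
  ring

/-- Two periodic contact forms that agree along the line are linearly isotopic through contact forms
on a tube. -/
theorem exists_contact_tube {A₀ A₁ : Cover → Cover →L[ℝ] ℝ}
    (per₀ : ∀ z, A₀ (z + period) = A₀ z) (per₁ : ∀ z, A₁ (z + period) = A₁ z)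
    (smooth₀ : ∀ᶠ z in 𝓝ˢ line, ContDiffAt ℝ ∞ A₀ z)
    (smooth₁ : ∀ᶠ z in 𝓝ˢ line, ContDiffAt ℝ ∞ A₁ z)
    (heq : ∀ z ∈ line, A₁ z = A₀ z)
    (pos₀ : ∀ z ∈ line, 0 < wedgeAlg (A₀ z) (fderiv ℝ A₀ z))
    (pos₁ : ∀ z ∈ line, 0 < wedgeAlg (A₁ z) (fderiv ℝ A₁ z)) :
    ∃ δ > 0, ∀ z : Cover, ‖z.2‖ < δ → ContDiffAt ℝ ∞ A₀ z ∧ ContDiffAt ℝ ∞ A₁ z ∧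
      ∀ t ∈ Icc (0 : ℝ) 1, 0 < wedgeAlg (A₀ z + t • (A₁ z - A₀ z))
        (fderiv ℝ A₀ z + t • (fderiv ℝ A₁ z - fderiv ℝ A₀ z)) := by
  refine exists_tube (fun z => ?_) ?_
  · rw [contDiffAt_add_period per₀, contDiffAt_add_period per₁, fderiv_add_period per₀,
      fderiv_add_period per₁, per₀, per₁]
  · refine smooth₀.and (smooth₁.and ?_)
    rw [eventually_nhdsSet_iff_forall] at smooth₀ smooth₁ ⊢
    intro z hz
    -- Compactness of [0, 1] turns positivity near each (z, t) into positivity near z for all t at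
    -- once.
    refine isCompact_Icc.eventually_forall_of_forall_eventually fun t ht => ?_
    have c₀ := (smooth₀ z hz).self_of_nhds
    have c₁ := (smooth₁ z hz).self_of_nhds
    have e₀ := c₀.comp (z, t) (contDiffAt_fst (𝕜 := ℝ) (F := ℝ))
    have e₁ := c₁.comp (z, t) (contDiffAt_fst (𝕜 := ℝ) (F := ℝ))
    have f₀ := (c₀.fderiv_right (m := ∞) (by simp)).comp (z, t) (contDiffAt_fst (𝕜 := ℝ) (F := ℝ))
    have f₁ := (c₁.fderiv_right (m := ∞) (by simp)).comp (z, t) (contDiffAt_fst (𝕜 := ℝ) (F := ℝ))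
    have ht' : ContDiffAt ℝ ∞ (Prod.snd : Cover × ℝ → ℝ) (z, t) := contDiffAt_snd
    have := (contDiffAt_wedgeAlg (e₀.add (ht'.smul (e₁.sub e₀)))
      (f₀.add (ht'.smul (f₁.sub f₀)))).continuousAt
    refine this.eventually (lt_mem_nhds ?_)
    change 0 < wedgeAlg (A₀ z + t • (A₁ z - A₀ z))
      (fderiv ℝ A₀ z + t • (fderiv ℝ A₁ z - fderiv ℝ A₀ z))
    rw [heq z hz, sub_self, smul_zero, add_zero, wedgeAlg_convex]
    have h0 := pos₀ z hz
    have h1 := pos₁ z hz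
    rw [heq z hz] at h1
    rcases ht.1.eq_or_lt with rfl | h
    · simpa using h0
    · have := mul_pos h h1
      have := mul_nonneg (sub_nonneg.2 ht.2) h0.le
      linarith

/-- A vector field that is periodic and supported in a tube has bounded spatial derivative. -/
theorem exists_bound_spaceDeriv {X : ℝ × Cover → Cover} (hX : ContDiff ℝ ∞ X)
    (hper : ∀ t z, X (t, z + period) = X (t, z)) {r : ℝ}
    (hsupp : ∀ t (z : Cover), r < ‖z.2‖ → X (t, z) = 0) :
    ∃ K, ∀ t ∈ Icc (0 : ℝ) 1, ∀ x, ‖spaceDeriv X (t, x)‖ ≤ K := by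
  have hslice : ∀ t z, spaceDeriv X (t, z) = fderiv ℝ (fun z => X (t, z)) z := fun t z =>
    (((hX.differentiable (by simp) (t, z)).hasFDerivAt.comp z
      (hasFDerivAt_prodMk_right t z)).fderiv).symm
  have hcomp : IsCompact (Icc (0 : ℝ) 1 ×ˢ (Icc 0 (2 * Real.pi) ×ˢ
      Metric.closedBall (0 : EuclideanSpace ℝ (Fin 2)) r)) :=
    isCompact_Icc.prod (isCompact_Icc.prod (isCompact_closedBall _ _))
  obtain ⟨K, hK⟩ := hcomp.exists_bound_of_continuousOn (continuous_spaceDeriv hX).continuousOn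
  refine ⟨max K 0, fun t ht x => ?_⟩
  rcases lt_or_ge r ‖x.2‖ with h | h
  · have : (fun z => X (t, z)) =ᶠ[𝓝 x] fun _ => 0 := by
      filter_upwards [(isOpen_lt continuous_const (by fun_prop :
        Continuous fun z : Cover => ‖z.2‖)).mem_nhds h] with z hz using hsupp t z hz
    rw [hslice, this.fderiv_eq]
    simp
  · obtain ⟨θ, hθ, h2⟩ := exists_mem_Ico_of_periodic
      (P := fun z => ‖spaceDeriv X (t, z)‖ ≤ K) (fun z => by
        rw [hslice, hslice, fderiv_add_period (hper t)]) x
    exact (h2.2 (hK (t, (θ, x.2)) ⟨ht, ⟨hθ.1, hθ.2.le⟩, by simpa using h⟩)).trans (le_max_left _ _)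

/-- Two periodic contact forms that agree along the line have contactomorphic germs there. -/
theorem kernelRel_of_eqOn_line {A₀ A₁ : Cover → Cover →L[ℝ] ℝ}
    (per₀ : ∀ z, A₀ (z + period) = A₀ z) (per₁ : ∀ z, A₁ (z + period) = A₁ z)
    (smooth₀ : ∀ᶠ z in 𝓝ˢ line, ContDiffAt ℝ ∞ A₀ z)
    (smooth₁ : ∀ᶠ z in 𝓝ˢ line, ContDiffAt ℝ ∞ A₁ z)
    (heq : ∀ z ∈ line, A₁ z = A₀ z)
    (pos₀ : ∀ z ∈ line, 0 < wedgeAlg (A₀ z) (fderiv ℝ A₀ z))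
    (pos₁ : ∀ z ∈ line, 0 < wedgeAlg (A₁ z) (fderiv ℝ A₁ z)) : KernelRel A₀ A₁ := by
  obtain ⟨δ, hδ, htube⟩ := exists_contact_tube per₀ per₁ smooth₀ smooth₁ heq pos₀ pos₁
  -- Interpolating with ρ(t) instead of t keeps the coefficient in [0, 1] for every real t, so the
  -- field is defined and smooth for all times.
  let ρ := Real.smoothTransition
  have hρ : ContDiff ℝ ∞ ρ := Real.smoothTransition.contDiff
  have hρ' : ContDiff ℝ ∞ (deriv ρ) := hρ.iterate_deriv 1
  let B : ℝ × Cover → Cover →L[ℝ] ℝ := fun q => A₀ q.2 + ρ q.1 • (A₁ q.2 - A₀ q.2)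
  let D : ℝ × Cover → Cover →L[ℝ] Cover →L[ℝ] ℝ :=
    fun q => fderiv ℝ A₀ q.2 + ρ q.1 • (fderiv ℝ A₁ q.2 - fderiv ℝ A₀ q.2)
  let b : Cover → Cover →L[ℝ] ℝ := fun z => A₁ z - A₀ z
  -- This factor makes `cross_identity` cancel ρ' b against i_X dB, up to a multiple of B.
  let c : ℝ × Cover → ℝ := fun q => deriv ρ q.1 * (wedgeAlg (B q) (D q))⁻¹
  -- The cutoff is 1 on the tube of radius δ/3, where the Gray equation must hold, and vanishes
  -- beyond 2δ/3, so X extends by zero and has bounded spatial derivative.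
  let χ : ContDiffBump (0 : EuclideanSpace ℝ (Fin 2)) :=
    ⟨δ / 3, 2 * δ / 3, by positivity, by linarith⟩
  let X : ℝ × Cover → Cover := fun q => χ q.2.2 • (c q • cross (B q) (b q.2))
  have hW : ∀ q : ℝ × Cover, ‖q.2.2‖ < δ → 0 < wedgeAlg (B q) (D q) := fun q hq =>
    (htube q.2 hq).2.2 _ ⟨Real.smoothTransition.nonneg _, Real.smoothTransition.le_one _⟩
  have hB : ∀ q : ℝ × Cover, ‖q.2.2‖ < δ → ContDiffAt ℝ ∞ B q := by
    intro q hq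
    have h₀ := (htube q.2 hq).1.comp q contDiffAt_snd
    have h₁ := (htube q.2 hq).2.1.comp q contDiffAt_snd
    exact h₀.add ((hρ.contDiffAt.comp q contDiffAt_fst).smul (h₁.sub h₀))
  have hD : ∀ q : ℝ × Cover, ‖q.2.2‖ < δ → ContDiffAt ℝ ∞ D q := by
    intro q hq
    have h₀ := ((htube q.2 hq).1.fderiv_right (m := ∞) (by simp)).comp q contDiffAt_snd
    have h₁ := ((htube q.2 hq).2.1.fderiv_right (m := ∞) (by simp)).comp q contDiffAt_snd
    exact h₀.add ((hρ.contDiffAt.comp q contDiffAt_fst).smul (h₁.sub h₀))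
  have hb : ∀ q : ℝ × Cover, ‖q.2.2‖ < δ → ContDiffAt ℝ ∞ (fun q : ℝ × Cover => b q.2) q := by
    intro q hq
    exact ((htube q.2 hq).2.1.comp q contDiffAt_snd).sub ((htube q.2 hq).1.comp q contDiffAt_snd)
  have hc : ∀ q : ℝ × Cover, ‖q.2.2‖ < δ → ContDiffAt ℝ ∞ c q := by
    intro q hq
    exact (hρ'.contDiffAt.comp q contDiffAt_fst).mul
      ((contDiffAt_wedgeAlg (hB q hq) (hD q hq)).inv (hW q hq).ne')
  have hsupp : ∀ t (z : Cover), 2 * δ / 3 < ‖z.2‖ → X (t, z) = 0 := by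
    intro t z hz
    have : χ z.2 = 0 := χ.zero_of_le_dist (by simpa using hz.le)
    simp [X, this]
  have hX : ContDiff ℝ ∞ X := by
    rw [contDiff_iff_contDiffAt]
    intro q
    rcases lt_or_ge ‖q.2.2‖ δ with h | h
    · exact (χ.contDiff.contDiffAt.comp q (contDiffAt_snd.comp q contDiffAt_snd)).smul
        ((hc q h).smul (contDiffAt_cross (hB q h) (hb q h)))
    · have : X =ᶠ[𝓝 q] fun _ => 0 := by
        filter_upwards [(isOpen_lt continuous_const (by fun_prop :
          Continuous fun q : ℝ × Cover => ‖q.2.2‖)).mem_nhds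
            (show 2 * δ / 3 < ‖q.2.2‖ by linarith)] with q' hq' using hsupp q'.1 q'.2 hq'
      exact contDiffAt_const.congr_of_eventuallyEq this
  have hXper : ∀ t z, X (t, z + period) = X (t, z) := by
    intro t z
    have hz : (z + period).2 = z.2 := by simp [period]
    simp only [X, c, B, D, b, per₀, per₁, fderiv_add_period per₀, fderiv_add_period per₁, hz]
  have hU : ∀ z : Cover, ‖z.2‖ < δ / 3 → ‖z.2‖ < δ := fun z hz => by linarith
  have hX1 : ∀ t (z : Cover), ‖z.2‖ < δ / 3 →
      X (t, z) = c (t, z) • cross (B (t, z)) (b z) := by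
    intro t z hz
    have : χ z.2 = 1 := χ.one_of_mem_closedBall (by simpa using hz.le)
    simp [X, this]
  have hgray : IsGrayField X B (fun q => c q * wedgeAlg (b q.2) (D q))
      {z : Cover | ‖z.2‖ < δ / 3} :=
    { smooth := hX
      periodic := hXper
      eq_zero := fun t z hz => by
        have : b z = 0 := sub_eq_zero.2 (heq z hz)
        simp [X, this, cross]
      isOpen := isOpen_lt (by fun_prop) continuous_const
      line_subset := fun z (hz : z.2 = 0) => by
        simp only [mem_ofPred_eq, hz, norm_zero]
        positivity
      differentiableAt := fun t z hz => (hB (t, z) (hU z hz)).differentiableAt (by simp)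
      continuousOn := fun q hq => ContinuousAt.continuousWithinAt
        (((hc q (hU _ hq.2)).mul (contDiffAt_wedgeAlg (hb q (hU _ hq.2))
          (hD q (hU _ hq.2)))).continuousAt)
      tangent := fun t z hz => by
        rw [hX1 t z hz, map_smul, apply_cross_self, smul_zero]
      gray := fun t z hz w => by
        have h₀ := ((htube z (hU z hz)).1.differentiableAt (by simp)).hasFDerivAt.comp
          (t, z) (hasFDerivAt_snd (𝕜 := ℝ))
        have h₁ := ((htube z (hU z hz)).2.1.differentiableAt (by simp)).hasFDerivAt.comp
          (t, z) (hasFDerivAt_snd (𝕜 := ℝ))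
        have h₂ := (hρ.differentiable (by simp) t).hasDerivAt.hasFDerivAt.comp
          (t, z) (hasFDerivAt_fst (𝕜 := ℝ))
        have h₃ := (h₀.add (h₂.smul (h₁.sub h₀))).fderiv
        have h₄ : ∀ s v, fderiv ℝ B (t, z) (s, v) = D (t, z) v + (s * deriv ρ t) • b z := by
          intro s v
          refine (DFunLike.congr_fun h₃ (s, v)).trans ?_
          simp [D, b]
          module
        have hne := (hW (t, z) (hU z hz)).ne'
        have hid := cross_identity (B (t, z)) (b z) (D (t, z)) w
        rw [hX1 t z hz, h₄, h₄]
        simp only [map_smul, add_apply, smul_apply, smul_eq_mul, one_mul, zero_mul, add_zero]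
        simp only [c, mul_assoc, ← hid]
        field_simp
        ring }
  obtain ⟨K, hK⟩ := exists_bound_spaceDeriv hX hXper hsupp
  have := hgray.kernelRel hK
  simpa [B, ρ] using this

end Moser

/-! ### Shear-rotations and their effect on 1-forms -/

section Normalization

/-- A smooth curve `(p, q) / a`, defined where `a ≠ 0`, omits a point of the plane. -/
theorem exists_avoid_curve {a p q : ℝ → ℝ} (ha : Differentiable ℝ a) (hp : Differentiable ℝ p)
    (hq : Differentiable ℝ q) :
    ∃ k l : ℝ, ∀ t, a t ≠ 0 → p t + a t * k ≠ 0 ∨ q t + a t * l ≠ 0 := by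
  -- The curve is read as a map of the plane that ignores the second variable, restricted to part of
  -- a line. That set is null, and a differentiable map between spaces of equal dimension sends null
  -- sets to null sets.
  let f : ℝ × ℝ → ℝ × ℝ := fun z => (-(p z.1 / a z.1), -(q z.1 / a z.1))
  let s : Set (ℝ × ℝ) := {t | a t ≠ 0} ×ˢ {0}
  have hf : DifferentiableOn ℝ f s := by
    intro z hz
    refine DifferentiableAt.differentiableWithinAt ?_
    have h1 : a z.1 ≠ 0 := hz.1
    have ha1 : DifferentiableAt ℝ (fun z : ℝ × ℝ => a z.1) z := (ha _).comp z differentiableAt_fst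
    have hp1 : DifferentiableAt ℝ (fun z : ℝ × ℝ => p z.1) z := (hp _).comp z differentiableAt_fst
    have hq1 : DifferentiableAt ℝ (fun z : ℝ × ℝ => q z.1) z := (hq _).comp z differentiableAt_fst
    simp only [f, div_eq_mul_inv]
    have hi := ha1.fun_inv h1
    exact (hp1.fun_mul hi).fun_neg.prodMk (hq1.fun_mul hi).fun_neg
  have hs : (MeasureTheory.volume : MeasureTheory.Measure (ℝ × ℝ)) s = 0 := by
    rw [MeasureTheory.Measure.volume_eq_prod, MeasureTheory.Measure.prod_prod]
    simp
  have himg := MeasureTheory.addHaar_image_eq_zero_of_differentiableOn_of_addHaar_eq_zero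
    MeasureTheory.volume hf hs
  have hne : f '' s ≠ univ := by
    intro h
    rw [h] at himg
    exact (isOpen_univ.measure_pos MeasureTheory.volume univ_nonempty).ne' himg
  obtain ⟨⟨k, l⟩, hkl⟩ := (ne_univ_iff_exists_notMem _).1 hne
  refine ⟨k, l, fun t ht => ?_⟩
  by_contra! h
  refine hkl ⟨(t, 0), ⟨ht, rfl⟩, ?_⟩
  simp only [f, Prod.mk.injEq]
  constructor
  · field_simp
    linarith [h.1]
  · field_simp
    linarith [h.2]

/-- The coordinate `x` on the cover. -/
def coordX : Cover →L[ℝ] ℝ := (EuclideanSpace.proj 0).comp (ContinuousLinearMap.snd ℝ ℝ _)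

/-- The coordinate `y` on the cover. -/
def coordY : Cover →L[ℝ] ℝ := (EuclideanSpace.proj 1).comp (ContinuousLinearMap.snd ℝ ℝ _)

theorem coordX_of_mem_line {z : Cover} (hz : z ∈ line) : coordX z = 0 := by
  simp [coordX, show z.2 = 0 from hz]

theorem coordY_of_mem_line {z : Cover} (hz : z ∈ line) : coordY z = 0 := by
  simp [coordY, show z.2 = 0 from hz]

@[simp] theorem coordX_eθ : coordX eθ = 0 := by simp [coordX, eθ]
@[simp] theorem coordX_eX : coordX eX = 1 := by simp [coordX, eX]
@[simp] theorem coordX_eY : coordX eY = 0 := by simp [coordX, eY]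
@[simp] theorem coordY_eθ : coordY eθ = 0 := by simp [coordY, eθ]
@[simp] theorem coordY_eX : coordY eX = 0 := by simp [coordY, eX]
@[simp] theorem coordY_eY : coordY eY = 1 := by simp [coordY, eY]

theorem eq_sum_coord (w : Cover) : w = w.1 • eθ + coordX w • eX + coordY w • eY :=
  eq_sum_coords w

/-- The fibrewise affine map `(θ, ζ) ↦ (θ + s(θ) · ζ, w(θ) ζ)`, where `w(θ)` acts by complex
multiplication. -/
def shearRotation (s₁ s₂ w₁ w₂ : ℝ → ℝ) (z : Cover) : Cover :=
  (z.1 + s₁ z.1 * coordX z + s₂ z.1 * coordY z) • eθ +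
    (w₁ z.1 * coordX z - w₂ z.1 * coordY z) • eX + (w₂ z.1 * coordX z + w₁ z.1 * coordY z) • eY

/-- The derivative of `shearRotation` along the line. -/
def shearRotationDeriv (s₁ s₂ w₁ w₂ : ℝ) : Cover →L[ℝ] Cover :=
  (ContinuousLinearMap.fst ℝ ℝ _ + s₁ • coordX + s₂ • coordY).smulRight eθ +
    (w₁ • coordX - w₂ • coordY).smulRight eX + (w₂ • coordX + w₁ • coordY).smulRight eY

variable {s₁ s₂ w₁ w₂ : ℝ → ℝ}

theorem contDiff_shearRotation (hs₁ : ContDiff ℝ ∞ s₁) (hs₂ : ContDiff ℝ ∞ s₂)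
    (hw₁ : ContDiff ℝ ∞ w₁) (hw₂ : ContDiff ℝ ∞ w₂) :
    ContDiff ℝ ∞ (shearRotation s₁ s₂ w₁ w₂) := by
  unfold shearRotation
  fun_prop

theorem shearRotation_of_mem_line {z : Cover} (hz : z ∈ line) :
    shearRotation s₁ s₂ w₁ w₂ z = z := by
  conv_rhs => rw [eq_sum_coord z]
  simp [shearRotation, coordX_of_mem_line hz, coordY_of_mem_line hz]

theorem shearRotation_add_period (hs₁ : ∀ t, s₁ (t + 2 * Real.pi) = s₁ t)
    (hs₂ : ∀ t, s₂ (t + 2 * Real.pi) = s₂ t) (hw₁ : ∀ t, w₁ (t + 2 * Real.pi) = w₁ t)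
    (hw₂ : ∀ t, w₂ (t + 2 * Real.pi) = w₂ t) (z : Cover) :
    shearRotation s₁ s₂ w₁ w₂ (z + period) = shearRotation s₁ s₂ w₁ w₂ z + period := by
  have h1 : (z + period).1 = z.1 + 2 * Real.pi := rfl
  have hX : coordX (z + period) = coordX z := by simp [coordX, period]
  have hY : coordY (z + period) = coordY z := by simp [coordY, period]
  have hp : period = (2 * Real.pi) • eθ := by simp [period, eθ]
  simp only [shearRotation, h1, hX, hY, hs₁, hs₂, hw₁, hw₂]
  rw [hp]
  module

theorem hasFDerivAt_mul_of_eq_zero {f : ℝ → ℝ} (hf : Differentiable ℝ f) (l : Cover →L[ℝ] ℝ)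
    {z : Cover} (hl : l z = 0) : HasFDerivAt (fun z : Cover => f z.1 * l z) (f z.1 • l) z := by
  have := ((hf z.1).hasFDerivAt.comp z (hasFDerivAt_fst (𝕜 := ℝ))).mul (l.hasFDerivAt (x := z))
  refine this.congr_fderiv ?_
  simp [hl]

theorem hasFDerivAt_shearRotation (hs₁ : Differentiable ℝ s₁) (hs₂ : Differentiable ℝ s₂)
    (hw₁ : Differentiable ℝ w₁) (hw₂ : Differentiable ℝ w₂) {z : Cover} (hz : z ∈ line) :
    HasFDerivAt (shearRotation s₁ s₂ w₁ w₂)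
      (shearRotationDeriv (s₁ z.1) (s₂ z.1) (w₁ z.1) (w₂ z.1)) z := by
  have hX := coordX_of_mem_line hz
  have hY := coordY_of_mem_line hz
  exact ((((hasFDerivAt_fst (𝕜 := ℝ)).add (hasFDerivAt_mul_of_eq_zero hs₁ _ hX)).add
    (hasFDerivAt_mul_of_eq_zero hs₂ _ hY)).smul_const eθ).add
    (((hasFDerivAt_mul_of_eq_zero hw₁ _ hX).sub
      (hasFDerivAt_mul_of_eq_zero hw₂ _ hY)).smul_const eX) |>.add
    (((hasFDerivAt_mul_of_eq_zero hw₂ _ hX).add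
      (hasFDerivAt_mul_of_eq_zero hw₁ _ hY)).smul_const eY)

theorem isInvertible_of_injective {L : Cover →L[ℝ] Cover} (h : ∀ v, L v = 0 → v = 0) :
    L.IsInvertible :=
  ⟨(LinearEquiv.ofInjectiveEndo L.toLinearMap
    ((injective_iff_map_eq_zero _).2 h)).toContinuousLinearEquiv, ContinuousLinearMap.ext fun _ => rfl⟩

section Deriv

variable {a b c d : ℝ}

theorem shearRotationDeriv_eθ : shearRotationDeriv a b c d eθ = eθ := by
  simp [shearRotationDeriv]
  simp [eθ]

theorem shearRotationDeriv_eX : shearRotationDeriv a b c d eX = a • eθ + c • eX + d • eY := by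
  simp [shearRotationDeriv]
  simp [eX]

theorem shearRotationDeriv_eY : shearRotationDeriv a b c d eY = b • eθ + (-d) • eX + c • eY := by
  simp [shearRotationDeriv]
  simp [eY]

theorem isInvertible_shearRotationDeriv (h : 0 < c ^ 2 + d ^ 2) :
    (shearRotationDeriv a b c d).IsInvertible := by
  refine isInvertible_of_injective fun v hv => ?_
  have hX := congrArg coordX hv
  have hY := congrArg coordY hv
  simp [shearRotationDeriv] at hX hY
  -- This is multiplication by the conjugate of c + id.
  have h1 : (c ^ 2 + d ^ 2) * coordX v = 0 := by linear_combination c * hX + d * hY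
  have h2 : (c ^ 2 + d ^ 2) * coordY v = 0 := by linear_combination c * hY - d * hX
  have h3 := (mul_eq_zero.1 h1).resolve_left h.ne'
  have h4 := (mul_eq_zero.1 h2).resolve_left h.ne'
  have h5 := congrArg Prod.fst hv
  simp [shearRotationDeriv, h3, h4, eθ] at h5
  rw [eq_sum_coord v, h3, h4, h5]
  simp

/-- The transformation law of `a ∧ da` under scaling by a function and pull-back. -/
theorem wedgeAlg_pullback {A A' : Cover →L[ℝ] ℝ} {D D' S : Cover →L[ℝ] Cover →L[ℝ] ℝ} {m : ℝ}
    {m' : Cover →L[ℝ] ℝ} (hA' : ∀ v, A' v = m * A (shearRotationDeriv a b c d v))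
    (hD' : ∀ v w, D' v w = m' v * A (shearRotationDeriv a b c d w) +
      m * (D (shearRotationDeriv a b c d v) (shearRotationDeriv a b c d w) + S v w))
    (hS : ∀ v w, S v w = S w v) :
    wedgeAlg A' D' = m ^ 2 * (c ^ 2 + d ^ 2) * wedgeAlg A D := by
  -- The m' terms cancel because they enter as A ∧ A, and S cancels by symmetry; what remains is the
  -- determinant c² + d² of the shear-rotation.
  simp only [wedgeAlg, hA', hD', shearRotationDeriv_eθ, shearRotationDeriv_eX,
    shearRotationDeriv_eY, map_add, map_smul, add_apply, smul_apply, smul_eq_mul,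
    hS eX eθ, hS eY eθ, hS eY eX]
  ring

end Deriv

end Normalization

/-! ### Making the two forms agree along the line -/

section Normalization

/-- The coefficients of a shear-rotation which makes two coefficient vectors agree. -/
theorem exists_coefficients {a b₁ c₁ b₂ c₂ : ℝ → ℝ} (ha : ContDiff ℝ ∞ a) (hb₁ : ContDiff ℝ ∞ b₁)
    (hc₁ : ContDiff ℝ ∞ c₁) (hb₂ : ContDiff ℝ ∞ b₂) (hc₂ : ContDiff ℝ ∞ c₂)
    (h₁ : ∀ t, a t = 0 → 0 < b₁ t ^ 2 + c₁ t ^ 2) (h₂ : ∀ t, a t = 0 → 0 < b₂ t ^ 2 + c₂ t ^ 2)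
    {T : ℝ} (pa : ∀ t, a (t + T) = a t) (pb₁ : ∀ t, b₁ (t + T) = b₁ t)
    (pc₁ : ∀ t, c₁ (t + T) = c₁ t) (pb₂ : ∀ t, b₂ (t + T) = b₂ t) (pc₂ : ∀ t, c₂ (t + T) = c₂ t) :
    ∃ s₁ s₂ w₁ w₂ : ℝ → ℝ, ContDiff ℝ ∞ s₁ ∧ ContDiff ℝ ∞ s₂ ∧ ContDiff ℝ ∞ w₁ ∧ ContDiff ℝ ∞ w₂ ∧
      (∀ t, s₁ (t + T) = s₁ t) ∧ (∀ t, s₂ (t + T) = s₂ t) ∧ (∀ t, w₁ (t + T) = w₁ t) ∧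
      (∀ t, w₂ (t + T) = w₂ t) ∧ (∀ t, 0 < w₁ t ^ 2 + w₂ t ^ 2) ∧
      (∀ t, s₁ t * a t + w₁ t * b₂ t + w₂ t * c₂ t = b₁ t) ∧
      ∀ t, s₂ t * a t - w₂ t * b₂ t + w₁ t * c₂ t = c₁ t := by
  have hP : ContDiff ℝ ∞ fun t => b₁ t * b₂ t + c₁ t * c₂ t := by fun_prop
  have hQ : ContDiff ℝ ∞ fun t => b₁ t * c₂ t - c₁ t * b₂ t := by fun_prop
  obtain ⟨k, l, hkl⟩ := exists_avoid_curve (ha.differentiable (by simp))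
    (hP.differentiable (by simp)) (hQ.differentiable (by simp))
  have hD : ∀ t, 0 < b₂ t ^ 2 + c₂ t ^ 2 + a t ^ 2 := by
    intro t
    rcases eq_or_ne (a t) 0 with h | h
    · simpa [h] using h₂ t h
    · positivity
  have hD' : ContDiff ℝ ∞ fun t => (b₂ t ^ 2 + c₂ t ^ 2 + a t ^ 2)⁻¹ :=
    ContDiff.inv (by fun_prop) fun t => (hD t).ne'
  -- With βⱼ = bⱼ + i cⱼ and κ = k + i l, these are the real and imaginary parts of S = (aβ₁ -
  -- κ̄β₂)/(|β₂|² + a²) and w = (β̄₁β₂ + aκ)/(|β₂|² + a²). A constant κ preserves periodicity.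
  refine ⟨fun t => (a t * b₁ t - k * b₂ t - l * c₂ t) * (b₂ t ^ 2 + c₂ t ^ 2 + a t ^ 2)⁻¹,
    fun t => (a t * c₁ t - k * c₂ t + l * b₂ t) * (b₂ t ^ 2 + c₂ t ^ 2 + a t ^ 2)⁻¹,
    fun t => (b₁ t * b₂ t + c₁ t * c₂ t + a t * k) * (b₂ t ^ 2 + c₂ t ^ 2 + a t ^ 2)⁻¹,
    fun t => (b₁ t * c₂ t - c₁ t * b₂ t + a t * l) * (b₂ t ^ 2 + c₂ t ^ 2 + a t ^ 2)⁻¹,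
    by fun_prop, by fun_prop, by fun_prop, by fun_prop, fun t => by simp only [pa, pb₁, pb₂, pc₂],
    fun t => by simp only [pa, pc₁, pb₂, pc₂], fun t => by simp only [pa, pb₁, pc₁, pb₂, pc₂],
    fun t => by simp only [pa, pb₁, pc₁, pb₂, pc₂], fun t => ?_, fun t => ?_, fun t => ?_⟩
  · have hne : 0 < (b₁ t * b₂ t + c₁ t * c₂ t + a t * k) ^ 2 +
        (b₁ t * c₂ t - c₁ t * b₂ t + a t * l) ^ 2 := by
      rcases eq_or_ne (a t) 0 with h | h
      -- For a = 0 the sum of squares is |β̄₁β₂|² = |β₁|²|β₂|².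
      · have := mul_pos (h₁ t h) (h₂ t h)
        rw [h]
        linarith
      · rcases hkl t h with h | h <;> positivity
    rw [mul_pow, mul_pow, ← add_mul]
    exact mul_pos hne (pow_pos (inv_pos.2 (hD t)) 2)
  · have := (hD t).ne'
    field_simp
    ring
  · have := (hD t).ne'
    field_simp
    ring

/-- A form rescaled and pulled back by a periodic diffeomorphism fixing the line. -/
def rescaledPullback (m : ℝ → ℝ) (Φ : Cover → Cover) (A : Cover → Cover →L[ℝ] ℝ) (z : Cover) :
    Cover →L[ℝ] ℝ :=
  m z.1 • (A (Φ z)).comp (fderiv ℝ Φ z)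

theorem hasFDerivAt_rescaledPullback {m : ℝ → ℝ} {Φ : Cover → Cover} {A : Cover → Cover →L[ℝ] ℝ}
    {z : Cover} (hm : ContDiff ℝ ∞ m) (hΦ : ContDiff ℝ ∞ Φ) (hA : ContDiffAt ℝ ∞ A (Φ z))
    (v w : Cover) :
    fderiv ℝ (rescaledPullback m Φ A) z v w = (deriv m z.1 * v.1) * A (Φ z) (fderiv ℝ Φ z w) +
      m z.1 * (fderiv ℝ A (Φ z) (fderiv ℝ Φ z v) (fderiv ℝ Φ z w) +
        A (Φ z) (fderiv ℝ (fderiv ℝ Φ) z v w)) := by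
  have h1 := (hm.differentiable (by simp) z.1).hasDerivAt.hasFDerivAt.comp z
    (hasFDerivAt_fst (𝕜 := ℝ))
  have h2 := (hA.differentiableAt (by simp)).hasFDerivAt.comp z
    (hΦ.differentiable (by simp) z).hasFDerivAt
  have h3 := ((hΦ.fderiv_right (m := ∞) (by simp)).differentiable (by simp) z).hasFDerivAt
  have h4 := DFunLike.congr_fun (DFunLike.congr_fun (h1.smul (h2.clm_comp h3)).fderiv v) w
  refine h4.trans ?_
  simp
  ring

theorem contDiffAt_rescaledPullback {m : ℝ → ℝ} {Φ : Cover → Cover} {A : Cover → Cover →L[ℝ] ℝ}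
    {z : Cover} (hm : ContDiff ℝ ∞ m) (hΦ : ContDiff ℝ ∞ Φ) (hA : ContDiffAt ℝ ∞ A (Φ z)) :
    ContDiffAt ℝ ∞ (rescaledPullback m Φ A) z :=
  (hm.contDiffAt.comp z contDiffAt_fst).smul
    ((hA.comp z hΦ.contDiffAt).clm_comp (hΦ.fderiv_right (m := ∞) (by simp)).contDiffAt)

theorem tendsto_nhdsSet_line {Φ : Cover → Cover} (hΦ : Continuous Φ)
    (hline : ∀ z ∈ line, Φ z = z) : Tendsto Φ (𝓝ˢ line) (𝓝ˢ line) :=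
  hΦ.tendsto_nhdsSet fun z hz => by rwa [hline z hz]

theorem kernelRel_rescaledPullback {m : ℝ → ℝ} {Φ : Cover → Cover} (A : Cover → Cover →L[ℝ] ℝ)
    (hm0 : ∀ t, m t ≠ 0) (hΦ : ContDiff ℝ ∞ Φ)
    (hper : ∀ z, Φ (z + period) = Φ z + period) (hline : ∀ z ∈ line, Φ z = z)
    (hinv : ∀ z ∈ line, (fderiv ℝ Φ z).IsInvertible) :
    KernelRel (rescaledPullback m Φ A) A := by
  refine ⟨Φ, hper, hline, ?_⟩
  have : ∀ᶠ z in 𝓝ˢ line, (fderiv ℝ Φ z).IsInvertible := by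
    rw [eventually_nhdsSet_iff_forall]
    intro z hz
    obtain ⟨e, he⟩ := hinv z hz
    exact (hΦ.continuous_fderiv (by simp)).continuousAt.preimage_mem_nhds
      (he ▸ ContinuousLinearEquiv.nhds e)
  filter_upwards [this] with z hz
  refine ⟨hΦ.contDiffAt, hz, fun v => ?_⟩
  simp [rescaledPullback, hm0]

/-- Periodic positive contact forms near the line whose values on `∂_θ` differ by a nonvanishing
factor have contactomorphic germs. -/
theorem kernelRel_of_tangential {A₁ A₂ : Cover → Cover →L[ℝ] ℝ}
    (per₁ : ∀ z, A₁ (z + period) = A₁ z) (per₂ : ∀ z, A₂ (z + period) = A₂ z)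
    (smooth₁ : ∀ᶠ z in 𝓝ˢ line, ContDiffAt ℝ ∞ A₁ z)
    (smooth₂ : ∀ᶠ z in 𝓝ˢ line, ContDiffAt ℝ ∞ A₂ z)
    (pos₁ : ∀ z ∈ line, 0 < wedgeAlg (A₁ z) (fderiv ℝ A₁ z))
    (pos₂ : ∀ z ∈ line, 0 < wedgeAlg (A₂ z) (fderiv ℝ A₂ z))
    {m : ℝ → ℝ} (hm : ContDiff ℝ ∞ m) (hm0 : ∀ t, m t ≠ 0)
    (perm : ∀ t, m (t + 2 * Real.pi) = m t)
    (htan : ∀ t, A₁ (t, 0) eθ = m t * A₂ (t, 0) eθ) : KernelRel A₁ A₂ := by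
  have hcoeff : ∀ {A : Cover → Cover →L[ℝ] ℝ}, (∀ᶠ z in 𝓝ˢ line, ContDiffAt ℝ ∞ A z) →
      ∀ v, ContDiff ℝ ∞ fun t : ℝ => A (t, 0) v := by
    intro A hA v
    rw [contDiff_iff_contDiffAt]
    intro t
    have := hA.self_of_nhdsSet (t, 0) rfl
    exact (this.comp t (contDiffAt_id.prodMk contDiffAt_const)).clm_apply contDiffAt_const
  have hpcoeff : ∀ {A : Cover → Cover →L[ℝ] ℝ}, (∀ z, A (z + period) = A z) → ∀ v (t : ℝ),
      A (t + 2 * Real.pi, 0) v = A (t, 0) v := by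
    intro A hA v t
    rw [← hA (t, 0)]
    simp [period]
  -- A contact form has no zeros: if it kills ∂_θ, its transverse part is nonzero.
  have hnonzero : ∀ {A : Cover → Cover →L[ℝ] ℝ} {z : Cover},
      0 < wedgeAlg (A z) (fderiv ℝ A z) → A z eθ = 0 → 0 < A z eX ^ 2 + A z eY ^ 2 := by
    intro A z hz h
    by_contra! h'
    have hx : A z eX = 0 := by nlinarith [sq_nonneg (A z eX), sq_nonneg (A z eY)]
    have hy : A z eY = 0 := by nlinarith [sq_nonneg (A z eX), sq_nonneg (A z eY)]
    simp [wedgeAlg, h, hx, hy] at hz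
  obtain ⟨s₁, s₂, w₁, w₂, hs₁, hs₂, hw₁, hw₂, ps₁, ps₂, pw₁, pw₂, hw, hX, hY⟩ :=
    exists_coefficients (a := fun t => A₁ (t, 0) eθ) (b₁ := fun t => A₁ (t, 0) eX)
      (c₁ := fun t => A₁ (t, 0) eY) (b₂ := fun t => m t * A₂ (t, 0) eX)
      (c₂ := fun t => m t * A₂ (t, 0) eY) (hcoeff smooth₁ _) (hcoeff smooth₁ _) (hcoeff smooth₁ _)
      (hm.mul (hcoeff smooth₂ _)) (hm.mul (hcoeff smooth₂ _))
      (fun t ht => hnonzero (pos₁ (t, 0) rfl) ht)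
      (fun t ht => by
        have h0 := hm0 t
        have := hnonzero (pos₂ (t, 0) rfl) (by simpa [htan, h0] using ht)
        rw [mul_pow, mul_pow, ← mul_add]
        positivity)
      (T := 2 * Real.pi) (hpcoeff per₁ _) (hpcoeff per₁ _) (hpcoeff per₁ _)
      (fun t => by rw [perm, hpcoeff per₂]) (fun t => by rw [perm, hpcoeff per₂])
  set Φ := shearRotation s₁ s₂ w₁ w₂ with hΦdef
  have hΦ : ContDiff ℝ ∞ Φ := contDiff_shearRotation hs₁ hs₂ hw₁ hw₂
  have hΦper : ∀ z, Φ (z + period) = Φ z + period := shearRotation_add_period ps₁ ps₂ pw₁ pw₂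
  have hΦline : ∀ z ∈ line, Φ z = z := fun z hz => shearRotation_of_mem_line hz
  have hΦd : ∀ z ∈ line, fderiv ℝ Φ z =
      shearRotationDeriv (s₁ z.1) (s₂ z.1) (w₁ z.1) (w₂ z.1) := fun z hz =>
    (hasFDerivAt_shearRotation (hs₁.differentiable (by simp)) (hs₂.differentiable (by simp))
      (hw₁.differentiable (by simp)) (hw₂.differentiable (by simp)) hz).fderiv
  refine (kernelRel_of_eqOn_line (A₁ := rescaledPullback m Φ A₂) per₁ ?_ smooth₁ ?_ ?_ pos₁
    ?_).trans (kernelRel_rescaledPullback A₂ hm0 hΦ hΦper hΦline fun z hz => ?_)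
  · intro z
    have hd : fderiv ℝ Φ (z + period) = fderiv ℝ Φ z := by
      rw [← fderiv_comp_add_right, funext hΦper, fderiv_add_const]
    have h1 : (z + period).1 = z.1 + 2 * Real.pi := rfl
    rw [rescaledPullback, rescaledPullback, hd, hΦper, per₂, h1, perm]
  · filter_upwards [(tendsto_nhdsSet_line hΦ.continuous hΦline).eventually smooth₂] with z hz
      using contDiffAt_rescaledPullback hm hΦ hz
  · rintro ⟨t, y⟩ hz
    obtain rfl : y = 0 := hz
    have hz : ((t, 0) : Cover) ∈ line := rfl
    refine ContinuousLinearMap.ext fun v => ?_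
    rw [rescaledPullback, hΦline _ hz, hΦd _ hz, eq_sum_coord v]
    have hX := hX t
    have hY := hY t
    have ht := htan t
    simp only [ContinuousLinearMap.comp_apply, smul_apply, map_add, map_smul, smul_eq_mul,
      shearRotationDeriv_eθ, shearRotationDeriv_eX, shearRotationDeriv_eY]
    linear_combination coordX v * hX + coordY v * hY -
      (v.1 + coordX v * s₁ t + coordY v * s₂ t) * ht
  · intro z hz
    have hA : ContDiffAt ℝ ∞ A₂ (Φ z) := by
      rw [hΦline z hz]
      exact smooth₂.self_of_nhdsSet z hz
    -- The second derivative of Φ drops out of d(Φ^*A₂) by symmetry, so positivity on the line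
    -- depends only on the first derivative of Φ.
    have hsymm : IsSymmSndFDerivAt ℝ Φ z :=
      hΦ.contDiffAt.isSymmSndFDerivAt (by
        rw [minSmoothness_of_isRCLikeNormedField]
        exact WithTop.coe_le_coe.2 (le_top : (2 : ℕ∞) ≤ ⊤))
    rw [wedgeAlg_pullback (A := A₂ z) (D := fderiv ℝ A₂ z) (m := m z.1)
      (m' := deriv m z.1 • ContinuousLinearMap.fst ℝ ℝ _)
      (S := (ContinuousLinearMap.compL ℝ Cover Cover ℝ (A₂ z)).comp (fderiv ℝ (fderiv ℝ Φ) z))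
      (a := s₁ z.1) (b := s₂ z.1) (c := w₁ z.1) (d := w₂ z.1) ?_ ?_ ?_]
    · have := hm0 z.1
      have := hw z.1
      have := pos₂ z hz
      positivity
    · intro v
      rw [rescaledPullback, hΦline z hz, hΦd z hz]
      rfl
    · intro v w
      rw [hasFDerivAt_rescaledPullback hm hΦ hA, hΦline z hz, hΦd z hz]
      rfl
    · intro v w
      exact congrArg (A₂ z) (hsymm v w)
  · rw [hΦd z hz]
    exact isInvertible_shearRotationDeriv (hw z.1)

end Normalization

/-! ### The covering map and the pull-back of forms -/

section Cover

theorem contMDiff_coverMap : ContMDiff 𝓘(ℝ, Cover) solidModel ∞ coverMap :=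
  (contMDiff_circleExp.comp contDiff_fst.contMDiff).prodMk contDiff_snd.contMDiff

theorem coverMap_surjective : Function.Surjective coverMap := fun p => by
  obtain ⟨t, ht⟩ := Circle.exp_surjective p.1
  exact ⟨(t, p.2), Prod.ext ht rfl⟩

theorem coverMap_add_period (z : Cover) : coverMap (z + period) = coverMap z := by
  simp [coverMap, period]

theorem coverMap_mem_core {z : Cover} : coverMap z ∈ core ↔ z ∈ line := Iff.rfl

/-- The smooth inverse of the covering map near `coverMap z`. -/
def coverInv (z : Cover) (p : Solid) : Cover :=
  (z.1 + Complex.arg (p.1 * (Circle.exp z.1)⁻¹ : Circle), p.2)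

theorem coverInv_coverMap {z q : Cover} (hq : q.1 - z.1 ∈ Ioo (-Real.pi) Real.pi) :
    coverInv z (coverMap q) = q := by
  have : Circle.exp q.1 * (Circle.exp z.1)⁻¹ = Circle.exp (q.1 - z.1) := by
    rw [← div_eq_mul_inv, ← Circle.exp_sub]
  ext1
  · simp only [coverInv, coverMap, this, Circle.arg_exp hq.1 hq.2.le]
    ring
  · rfl

theorem coverMap_coverInv (z : Cover) (p : Solid) : coverMap (coverInv z p) = p := by
  ext1
  · simp only [coverMap, coverInv, Circle.exp_add, Circle.exp_arg]
    exact mul_mul_inv_cancel'_right _ _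
  · rfl

/-- The covering map, restricted to a slice of width `2π`, as a diffeomorphism onto its image. -/
def coverDiffeo (z : Cover) : PartialDiffeomorph 𝓘(ℝ, Cover) solidModel Cover Solid ∞ where
  toFun := coverMap
  invFun := coverInv z
  source := {q | q.1 - z.1 ∈ Ioo (-Real.pi) Real.pi}
  target := {p | ((p.1 * (Circle.exp z.1)⁻¹ : Circle) : ℂ) ∈ Complex.slitPlane}
  map_source' := fun q hq => by
    have : Circle.exp q.1 * (Circle.exp z.1)⁻¹ = Circle.exp (q.1 - z.1) := by
      rw [← div_eq_mul_inv, ← Circle.exp_sub]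
    simp only [mem_ofPred_eq, coverMap, this, Complex.mem_slitPlane_iff_arg,
      Circle.arg_exp hq.1 hq.2.le]
    exact ⟨hq.2.ne, Circle.coe_ne_zero _⟩
  map_target' := fun p hp => by
    have h := Complex.mem_slitPlane_iff_arg.1 hp
    simp only [mem_ofPred_eq, coverInv, add_sub_cancel_left]
    exact ⟨Complex.neg_pi_lt_arg _, lt_of_le_of_ne (Complex.arg_le_pi _) h.1⟩
  left_inv' := fun q hq => coverInv_coverMap hq
  right_inv' := fun p _ => coverMap_coverInv z p
  open_source := isOpen_Ioo.preimage (by fun_prop)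
  open_target := Complex.isOpen_slitPlane.preimage
    (continuous_subtype_val.comp (continuous_fst.mul continuous_const))
  contMDiffOn_toFun := contMDiff_coverMap.contMDiffOn
  contMDiffOn_invFun := by
    have h1 : ContMDiff solidModel (𝓡 1) ∞ fun p : Solid => p.1 * (Circle.exp z.1)⁻¹ :=
      contMDiff_fst.mul contMDiff_const
    have h2 : ContMDiff solidModel 𝓘(ℝ, ℂ) ∞
        fun p : Solid => ((p.1 * (Circle.exp z.1)⁻¹ : Circle) : ℂ) :=
      haveI := finrank_real_complex_fact'
      (contMDiff_coe_sphere (E := ℂ) (n := 1)).comp h1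
    -- The argument is the imaginary part of the logarithm, which is smooth on the slit plane.
    have h3 : ContDiffOn ℝ ∞ (fun w : ℂ => z.1 + (Complex.log w).im) Complex.slitPlane :=
      fun w hw => (contDiffAt_const.add (Complex.imCLM.contDiff.contDiffAt.comp w
        ((Complex.contDiffAt_log hw).restrict_scalars ℝ))).contDiffWithinAt
    have h4 := h3.contMDiffOn.comp h2.contMDiffOn (fun p hp => hp :
      {p : Solid | ((p.1 * (Circle.exp z.1)⁻¹ : Circle) : ℂ) ∈ Complex.slitPlane} ⊆ _)
    exact (h4.prodMk_space contMDiff_snd.contMDiffOn).congr fun p _ => by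
      simp [coverInv, Complex.log_im]

theorem isLocalDiffeomorph_coverMap : IsLocalDiffeomorph 𝓘(ℝ, Cover) solidModel ∞ coverMap :=
  fun z => ⟨coverDiffeo z, by simp [coverDiffeo, Real.pi_pos], fun _ _ => rfl⟩

theorem mfderiv_coverMap_add_period (z : Cover) :
    (mfderiv 𝓘(ℝ, Cover) solidModel coverMap (z + period) :
      Cover →L[ℝ] EuclideanSpace ℝ (Fin 1) × EuclideanSpace ℝ (Fin 2)) =
    mfderiv 𝓘(ℝ, Cover) solidModel coverMap z := by
  have h1 : MDifferentiableAt 𝓘(ℝ, Cover) solidModel coverMap (z + period) :=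
    contMDiff_coverMap.mdifferentiable (by simp) _
  have h2 : HasMFDerivAt 𝓘(ℝ, Cover) 𝓘(ℝ, Cover) (fun z : Cover => z + period) z
      (ContinuousLinearMap.id ℝ Cover) :=
    ((hasFDerivAt_id z).add_const period).hasMFDerivAt
  have h3 := (h1.hasMFDerivAt.comp z h2).mfderiv
  have h4 : coverMap ∘ (fun z : Cover => z + period) = coverMap := funext coverMap_add_period
  rw [h4] at h3
  exact h3.symm

theorem pullback_add_period (α : OneForm) (z : Cover) :
    pullback α (z + period) = pullback α z := by
  -- The types of `α p` and `α q` depend on the base point, so the equality of points is eliminated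
  -- before the forms are compared in the model space.
  have key : ∀ (p q : Solid) (_ : p = q)
      (L : Cover →L[ℝ] EuclideanSpace ℝ (Fin 1) × EuclideanSpace ℝ (Fin 2)),
      ContinuousLinearMap.comp (α p : (EuclideanSpace ℝ (Fin 1) × EuclideanSpace ℝ (Fin 2)) →L[ℝ] ℝ)
        L = ContinuousLinearMap.comp
        (α q : (EuclideanSpace ℝ (Fin 1) × EuclideanSpace ℝ (Fin 2)) →L[ℝ] ℝ) L := by
    rintro p _ rfl L
    rfl
  refine (key _ _ (coverMap_add_period z) _).trans ?_
  rw [mfderiv_coverMap_add_period]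
  rfl

theorem contDiffAt_pullback {α : OneForm} {V : Set Solid} (hα : SmoothOn α V) (hV : IsOpen V)
    {z : Cover} (hz : coverMap z ∈ V) : ContDiffAt ℝ ∞ (pullback α) z := by
  suffices h : ContDiffOn ℝ ∞ (pullback α) (coverMap ⁻¹' V) from
    (h z hz).contDiffAt ((hV.preimage contMDiff_coverMap.continuous).mem_nhds hz)
  -- It suffices to evaluate on constant vectors v, whose images under the tangent map of the
  -- covering form a smooth family.
  rw [contDiffOn_clm_apply]
  intro v z hz
  have hα' := ((hα _ hz).contMDiffAt (hV.mem_nhds hz)).comp z contMDiff_coverMap.contMDiffAt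
  have hT : ContMDiff 𝓘(ℝ, Cover).tangent solidModel.tangent ∞
      (tangentMap 𝓘(ℝ, Cover) solidModel coverMap) :=
    contMDiff_coverMap.contMDiff_tangentMap (by simp)
  have hv : ContMDiff 𝓘(ℝ, Cover) 𝓘(ℝ, Cover).tangent ∞
      (fun z : Cover => (⟨z, v⟩ : TangentBundle 𝓘(ℝ, Cover) Cover)) :=
    contMDiff_vectorSpace_iff_contDiff.2 contDiff_const
  have h2 := ContMDiffAt.clm_bundle_apply (b := coverMap) (E₁ := TangentSpace solidModel)
    (E₂ := Trivial Solid ℝ) (ϕ := fun z => α (coverMap z))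
    (v := fun z => mfderiv 𝓘(ℝ, Cover) solidModel coverMap z v)
    hα' (hT.comp hv).contMDiffAt
  rw [contMDiffAt_totalSpace] at h2
  exact h2.2.contDiffAt.contDiffWithinAt

end Cover

/-! ### Local diffeomorphisms and their inverses -/

section LocalDiffeomorphisms

variable {E H M E' H' M' : Type*} [NormedAddCommGroup E] [NormedSpace ℝ E] [TopologicalSpace H]
  [TopologicalSpace M] [ChartedSpace H M] [NormedAddCommGroup E'] [NormedSpace ℝ E']
  [TopologicalSpace H'] [TopologicalSpace M'] [ChartedSpace H' M']
  {I : ModelWithCorners ℝ E H} {J : ModelWithCorners ℝ E' H'} {f g : M → M'} {x : M} {U : Set M}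

theorem isLocalDiffeomorphAt_of_openPartialHomeomorph (e : OpenPartialHomeomorph M M')
    (h1 : ContMDiffOn I J ∞ e e.source) (h2 : ContMDiffOn J I ∞ e.symm e.target)
    (hx : x ∈ e.source) (hf : EqOn f e e.source) : IsLocalDiffeomorphAt I J ∞ f x :=
  ⟨⟨e.toPartialEquiv, e.open_source, e.open_target, h1, h2⟩, hx, hf⟩

theorem isLocalDiffeomorphAt_congr (hg : IsLocalDiffeomorphAt I J ∞ g x) (hU : IsOpen U)
    (hx : x ∈ U) (h : EqOn f g U) : IsLocalDiffeomorphAt I J ∞ f x := by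
  obtain ⟨Φ, hxΦ, hΦ⟩ := hg
  refine isLocalDiffeomorphAt_of_openPartialHomeomorph
    (Φ.toOpenPartialHomeomorph.restrOpen U hU) ?_ ?_ ⟨hxΦ, hx⟩ fun y hy => ?_
  · exact Φ.contMDiffOn_toFun.mono inter_subset_left
  · exact Φ.contMDiffOn_invFun.mono inter_subset_left
  · exact (h hy.2).trans (hΦ hy.1)

theorem map_nhds_eq_of_isLocalDiffeomorphAt (h : IsLocalDiffeomorphAt I J ∞ f x) :
    map f (𝓝 x) = 𝓝 (f x) := by
  obtain ⟨Φ, hxΦ, hΦ⟩ := h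
  have h1 := Φ.toOpenPartialHomeomorph.map_nhds_eq hxΦ
  have h2 : f =ᶠ[𝓝 x] Φ := hΦ.eventuallyEq_of_mem (Φ.open_source.mem_nhds hxΦ)
  rw [map_congr h2, hΦ hxΦ]
  exact h1

theorem exists_injOn_nhds_of_isLocalDiffeomorphAt (h : IsLocalDiffeomorphAt I J ∞ f x) :
    ∃ u ∈ 𝓝 x, InjOn f u := by
  obtain ⟨Φ, hxΦ, hΦ⟩ := h
  exact ⟨Φ.source, Φ.open_source.mem_nhds hxΦ, hΦ.injOn_iff.2 Φ.toPartialEquiv.injOn⟩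

/-- An injective local diffeomorphism on an open set is a diffeomorphism onto an open image. -/
theorem exists_openPartialHomeomorph_of_injOn [Nonempty M] (hU : IsOpen U) (hinj : InjOn f U)
    (hf : ∀ x ∈ U, IsLocalDiffeomorphAt I J ∞ f x) :
    ∃ e : OpenPartialHomeomorph M M', e.source = U ∧ (∀ x, e x = f x) ∧
      ContMDiffOn I J ∞ e e.source ∧ ContMDiffOn J I ∞ e.symm e.target := by
  have hopen : IsOpenMap (U.domRestrict f) := by
    rw [isOpenMap_iff_nhds_le]
    rintro ⟨x, hx⟩
    change 𝓝 (f x) ≤ map (f ∘ Subtype.val) _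
    rw [← Filter.map_map, map_nhds_subtype_coe_eq_nhds hx (hU.mem_nhds hx),
      map_nhds_eq_of_isLocalDiffeomorphAt (hf x hx)]
  let e := OpenPartialHomeomorph.ofContinuousOpenRestrict (hinj.toPartialEquiv f U)
    (fun x hx => (hf x hx).contMDiffAt.continuousAt.continuousWithinAt) hopen hU
  refine ⟨e, rfl, fun _ => rfl, fun x hx => (hf x hx).contMDiffAt.contMDiffWithinAt, ?_⟩
  rintro _ ⟨x, hx, rfl⟩
  refine ContMDiffAt.contMDiffWithinAt ?_
  refine (hf x hx).localInverse_contMDiffAt.congr_of_eventuallyEq ?_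
  rw [EventuallyEq, ← map_nhds_eq_of_isLocalDiffeomorphAt (hf x hx), eventually_map]
  filter_upwards [hU.mem_nhds hx, (hf x hx).localInverse_eventuallyEq_left] with y hy hy'
  exact (e.left_inv hy).trans hy'.symm

/-- A smooth map with invertible derivative is a local diffeomorphism. -/
theorem isLocalDiffeomorphAt_of_isInvertible [CompleteSpace E] {F : E → E'} {z : E}
    (h : ∀ᶠ q in 𝓝 z, ContDiffAt ℝ ∞ F q ∧ (fderiv ℝ F q).IsInvertible) :
    IsLocalDiffeomorphAt 𝓘(ℝ, E) 𝓘(ℝ, E') ∞ F z := by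
  obtain ⟨O, hO, hOo, hzO⟩ := eventually_nhds_iff.1 h
  obtain ⟨hz, e', he'⟩ := h.self_of_nhds
  have hd : HasFDerivAt F (e' : E →L[ℝ] E') z := by
    rw [he']
    exact (hz.differentiableAt (by simp)).hasFDerivAt
  -- Restricting to O keeps the derivative invertible at every point of the source, so the inverse
  -- is smooth on the whole target and not only at the image of z.
  let e := (hz.toOpenPartialHomeomorph F hd (by simp)).restrOpen O hOo
  refine isLocalDiffeomorphAt_of_openPartialHomeomorph e ?_ ?_
    ⟨hz.mem_toOpenPartialHomeomorph_source hd (by simp), hzO⟩ fun _ _ => rfl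
  · intro q hq
    exact (hO q hq.2).1.contMDiffAt.contMDiffWithinAt
  · intro y hy
    obtain ⟨h1, e₁, he₁⟩ := hO (e.symm y) (e.map_target hy).2
    refine ContMDiffAt.contMDiffWithinAt (ContDiffAt.contMDiffAt ?_)
    refine e.contDiffAt_symm (f₀' := e₁) hy ?_ h1
    rw [he₁]
    exact (h1.differentiableAt (by simp)).hasFDerivAt

end LocalDiffeomorphisms

/-! ### Descent to the solid torus -/

section Descent

theorem exists_eq_add_zsmul_period {z z' : Cover} (h : coverMap z = coverMap z') :
    ∃ n : ℤ, z = z' + n • period := by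
  obtain ⟨m, hm⟩ := Circle.exp_eq_exp.1 (congrArg Prod.fst h)
  refine ⟨m, Prod.ext ?_ ?_⟩
  · simpa [period] using hm
  · have h2 : z.2 = z'.2 := congrArg (fun p : Solid => p.2) h
    simpa [period] using h2

/-- The map of `S¹ × ℝ²` covered by a map of the cover. -/
def descend (F : Cover → Cover) (p : Solid) : Solid :=
  coverMap (F (Function.surjInv coverMap_surjective p))

variable {F : Cover → Cover}

theorem descend_coverMap (hF : ∀ z, F (z + period) = F z + period) (z : Cover) :
    descend F (coverMap z) = coverMap (F z) := by
  obtain ⟨n, hn⟩ := exists_eq_add_zsmul_period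
    (Function.surjInv_eq coverMap_surjective (coverMap z))
  -- Equivariance says that the displacement F - id is periodic, hence invariant under all integer
  -- multiples of the period.
  have h1 : Function.Periodic (fun z => F z - z) period := fun z => by simp [hF]
  have h2 : Function.Periodic coverMap period := coverMap_add_period
  have h3 : F (z + n • period) = F z + n • period := by
    have : F (z + n • period) - (z + n • period) = F z - z := h1.zsmul n z
    rw [sub_eq_sub_iff_add_eq_add] at this
    have h4 : F (z + n • period) + z = (F z + n • period) + z := by
      rw [this]
      abel
    exact add_right_cancel h4
  rw [descend, hn, h3]
  exact h2.zsmul n _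

/-- Near `coverMap z` the descended map is `coverMap ∘ F` composed with a local inverse of the
covering. -/
theorem isLocalDiffeomorphAt_descend (hF : ∀ z, F (z + period) = F z + period) {z : Cover}
    (hz : IsLocalDiffeomorphAt 𝓘(ℝ, Cover) 𝓘(ℝ, Cover) ∞ F z) :
    IsLocalDiffeomorphAt solidModel solidModel ∞ (descend F) (coverMap z) := by
  have hc := isLocalDiffeomorph_coverMap z
  have hi := hc.localInverse_isLocalDiffeomorphAt
  have hinv : hc.localInverse (coverMap z) = z :=
    hc.localInverse_left_inv hc.localInverse_mem_target
  have hz' : IsLocalDiffeomorphAt 𝓘(ℝ, Cover) 𝓘(ℝ, Cover) ∞ F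
      (hc.localInverse (coverMap z)) := by
    rwa [hinv]
  have h1 := hi.comp (K := 𝓘(ℝ, Cover)) (hg := hz')
  have h2 := h1.comp (K := solidModel) (hg := isLocalDiffeomorph_coverMap _)
  refine isLocalDiffeomorphAt_congr h2 hc.localInverse.open_source hc.localInverse_mem_source
    fun p hp => ?_
  have h3 := hc.localInverse_right_inv hp
  conv_lhs => rw [← h3]
  rw [descend_coverMap hF]
  rfl

theorem mfderiv_descend_comp (hF : ∀ z, F (z + period) = F z + period) {z : Cover}
    (hz : IsLocalDiffeomorphAt 𝓘(ℝ, Cover) 𝓘(ℝ, Cover) ∞ F z) (v : Cover) :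
    mfderiv solidModel solidModel (descend F) (coverMap z)
      (mfderiv 𝓘(ℝ, Cover) solidModel coverMap z v) =
    mfderiv 𝓘(ℝ, Cover) solidModel coverMap (F z) (fderiv ℝ F z v) := by
  have hc := fun z => (contMDiff_coverMap.mdifferentiable (by simp) z).hasMFDerivAt
  have h1 := ((isLocalDiffeomorphAt_descend hF hz).mdifferentiableAt (by simp)).hasMFDerivAt.comp z
    (hc z)
  have h2 := (hc (F z)).comp z (hz.mdifferentiableAt (by simp)).hasMFDerivAt
  have h3 : descend F ∘ coverMap = coverMap ∘ F := funext (descend_coverMap hF)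
  rw [h3] at h1
  have h4 := DFunLike.congr_fun (hasMFDerivAt_unique h1 h2) v
  rw [mfderiv_eq_fderiv] at h4
  exact h4

theorem mfderiv_coverMap_surjective (z : Cover) :
    Function.Surjective (mfderiv 𝓘(ℝ, Cover) solidModel coverMap z) :=
  ((isLocalDiffeomorph_coverMap z).mfderivToContinuousLinearEquiv (by simp)).surjective

theorem oneForm_congr (α : OneForm) {p q : Solid} (h : p = q)
    (v : EuclideanSpace ℝ (Fin 1) × EuclideanSpace ℝ (Fin 2)) :
    (α p : (EuclideanSpace ℝ (Fin 1) × EuclideanSpace ℝ (Fin 2)) →L[ℝ] ℝ) v =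
      (α q : (EuclideanSpace ℝ (Fin 1) × EuclideanSpace ℝ (Fin 2)) →L[ℝ] ℝ) v := by
  subst h
  rfl

theorem map_ker_descend {α₁ α₂ : OneForm} (hF : ∀ z, F (z + period) = F z + period) {z : Cover}
    (hz : IsLocalDiffeomorphAt 𝓘(ℝ, Cover) 𝓘(ℝ, Cover) ∞ F z)
    (hinv : (fderiv ℝ F z).IsInvertible)
    (hker : ∀ v, pullback α₁ z v = 0 ↔ pullback α₂ (F z) (fderiv ℝ F z v) = 0) :
    Submodule.map (mfderiv solidModel solidModel (descend F) (coverMap z)).toLinearMap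
      (α₁ (coverMap z)).ker = (α₂ (descend F (coverMap z))).ker := by
  have hα : ∀ v, α₂ (descend F (coverMap z)) (mfderiv solidModel solidModel (descend F) (coverMap z)
      (mfderiv 𝓘(ℝ, Cover) solidModel coverMap z v)) = pullback α₂ (F z) (fderiv ℝ F z v) := by
    intro v
    rw [mfderiv_descend_comp hF hz v]
    exact oneForm_congr α₂ (descend_coverMap hF z) _
  ext w
  constructor
  · rintro ⟨u, hu, rfl⟩
    obtain ⟨v, rfl⟩ := mfderiv_coverMap_surjective z u
    exact (hα v).trans ((hker v).1 hu)
  -- Both the covering and F have invertible derivatives, so every vector of ker α₂ is the image of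
  -- some v; the equivalence `hker` then places v in ker α₁.
  · intro hw
    obtain ⟨w', hw'⟩ := mfderiv_coverMap_surjective (F z) w
    obtain ⟨e, he⟩ := hinv
    obtain ⟨v, rfl⟩ := e.surjective w'
    have hev : e v = fderiv ℝ F z v := DFunLike.congr_fun he v
    have hwv : mfderiv solidModel solidModel (descend F) (coverMap z)
        (mfderiv 𝓘(ℝ, Cover) solidModel coverMap z v) = w := by
      rw [mfderiv_descend_comp hF hz v, ← hev]
      exact hw'
    refine ⟨mfderiv 𝓘(ℝ, Cover) solidModel coverMap z v, (hker v).2 ?_, hwv⟩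
    rw [← hα v, hwv]
    exact hw

theorem isCompact_core : IsCompact core := by
  have : core = univ ×ˢ {0} := by
    ext p
    simp [core]
  rw [this]
  exact isCompact_univ.prod isCompact_singleton

theorem contactomorphicNearCore_of_kernelRel {α₁ α₂ : OneForm} {V₁ V₂ : Set Solid}
    (hV₁ : IsOpen V₁) (hV₂ : IsOpen V₂) (hS₁ : core ⊆ V₁) (hS₂ : core ⊆ V₂)
    (h : KernelRel (pullback α₁) (pullback α₂)) : ContactomorphicNearCore α₁ α₂ V₁ V₂ := by
  obtain ⟨F, hF, hline, hev⟩ := h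
  obtain ⟨O, hO, hlO, hprop⟩ := (hasBasis_nhdsSet line).eventually_iff.1 hev |>.imp fun O h =>
    (⟨h.1.1, h.1.2, fun z hz => h.2 hz⟩ : IsOpen O ∧ line ⊆ O ∧ ∀ z ∈ O, _)
  have hFd : ∀ z ∈ O, IsLocalDiffeomorphAt 𝓘(ℝ, Cover) 𝓘(ℝ, Cover) ∞ F z := fun z hz =>
    isLocalDiffeomorphAt_of_isInvertible (by
      filter_upwards [hO.mem_nhds hz] with q hq using ⟨(hprop q hq).1, (hprop q hq).2.1⟩)
  have hFc : ContinuousOn (coverMap ∘ F) O := fun z hz =>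
    (contMDiff_coverMap.continuous.continuousAt.comp
      (hprop z hz).1.continuousAt).continuousWithinAt
  let O' : Set Cover := (O ∩ (coverMap ∘ F) ⁻¹' V₂) ∩ coverMap ⁻¹' V₁
  have hO' : IsOpen O' :=
    (hFc.isOpen_inter_preimage hO hV₂).inter (hV₁.preimage contMDiff_coverMap.continuous)
  have hlO' : line ⊆ O' := fun z hz =>
    ⟨⟨hlO hz, by
      rw [mem_preimage, Function.comp_apply, hline z hz]
      exact hS₂ (coverMap_mem_core.2 hz)⟩, hS₁ (coverMap_mem_core.2 hz)⟩
  have hW : IsOpen (coverMap '' O') := isLocalDiffeomorph_coverMap.isOpenMap _ hO'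
  have hcW : core ⊆ coverMap '' O' := by
    intro p hp
    obtain ⟨z, rfl⟩ := coverMap_surjective p
    exact ⟨z, hlO' (coverMap_mem_core.1 hp), rfl⟩
  have hid : ∀ p ∈ core, descend F p = p := by
    intro p hp
    obtain ⟨z, rfl⟩ := coverMap_surjective p
    rw [descend_coverMap hF, hline z (coverMap_mem_core.1 hp)]
  have hfd : ∀ p ∈ coverMap '' O',
      IsLocalDiffeomorphAt solidModel solidModel ∞ (descend F) p := by
    rintro _ ⟨z, hz, rfl⟩
    exact isLocalDiffeomorphAt_descend hF (hFd z hz.1.1)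
  -- A locally injective map that is injective on a compact set is injective on a neighbourhood of
  -- it; here the map is the identity on the core.
  obtain ⟨t, ht, hinj⟩ := InjOn.exists_mem_nhdsSet (f := descend F) (s := core)
    (fun p hp q hq h => by rwa [hid p hp, hid q hq] at h) isCompact_core
    (fun p hp => (hfd p (hcW hp)).contMDiffAt.continuousAt)
    (fun p hp => exists_injOn_nhds_of_isLocalDiffeomorphAt (hfd p (hcW hp)))
  obtain ⟨e, hes, hef, he1, he2⟩ := exists_openPartialHomeomorph_of_injOn
    (hW.inter isOpen_interior) (hinj.mono (inter_subset_right.trans interior_subset))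
    (fun p hp => hfd p hp.1)
  have hefun : (e : Solid → Solid) = descend F := funext hef
  refine ⟨e, ?_, ?_, ?_, he1, he2, ?_, ?_⟩
  · rw [hes]
    exact subset_inter hcW (subset_interior_iff_mem_nhdsSet.2 ht)
  · rw [hes]
    rintro _ ⟨⟨z, hz, rfl⟩, -⟩
    exact hz.2
  · rw [← e.image_source_eq_target, hes, hefun]
    rintro _ ⟨_, ⟨⟨z, hz, rfl⟩, -⟩, rfl⟩
    rw [descend_coverMap hF]
    exact hz.1.2
  · rw [hes, hefun]
    rintro _ ⟨⟨z, hz, rfl⟩, -⟩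
    exact map_ker_descend hF (hFd z hz.1.1) (hprop z hz.1.1).2.1 (hprop z hz.1.1).2.2
  · rw [hefun]
    exact hid

theorem contactomorphicNearCore_of_tangential {α₁ α₂ : OneForm} {V₁ V₂ : Set Solid}
    (hV₁ : IsOpen V₁) (hV₂ : IsOpen V₂) (hS₁ : core ⊆ V₁) (hS₂ : core ⊆ V₂)
    (hα₁ : IsPositiveContactFormOn α₁ V₁) (hα₂ : IsPositiveContactFormOn α₂ V₂)
    {m : ℝ → ℝ} (hm : ContDiff ℝ ∞ m) (hm0 : ∀ t, m t ≠ 0)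
    (perm : ∀ t, m (t + 2 * Real.pi) = m t)
    (htan : ∀ t : ℝ, α₁ (coverMap (t, 0)) (dTheta (t, 0)) =
      m t * α₂ (coverMap (t, 0)) (dTheta (t, 0))) : ContactomorphicNearCore α₁ α₂ V₁ V₂ := by
  have hsmooth : ∀ {α : OneForm} {V : Set Solid}, IsOpen V → core ⊆ V →
      IsPositiveContactFormOn α V → ∀ᶠ z in 𝓝ˢ line, ContDiffAt ℝ ∞ (pullback α) z := by
    intro α V hV hS hα
    filter_upwards [(hV.preimage contMDiff_coverMap.continuous).mem_nhdsSet.2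
      fun z hz => hS (coverMap_mem_core.2 hz)] with z hz using contDiffAt_pullback hα.1 hV hz
  have hpos : ∀ {α : OneForm} {V : Set Solid}, IsOpen V → core ⊆ V →
      IsPositiveContactFormOn α V → ∀ z ∈ line,
        0 < wedgeAlg (pullback α z) (fderiv ℝ (pullback α) z) := by
    intro α V hV hS hα z hz
    have hzV := hS (coverMap_mem_core.2 hz)
    rw [← wedgeExtDeriv_eq ((contDiffAt_pullback hα.1 hV hzV).differentiableAt (by simp))]
    exact hα.2 z hzV
  exact contactomorphicNearCore_of_kernelRel hV₁ hV₂ hS₁ hS₂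
    (kernelRel_of_tangential (pullback_add_period α₁) (pullback_add_period α₂)
      (hsmooth hV₁ hS₁ hα₁) (hsmooth hV₂ hS₂ hα₂) (hpos hV₁ hS₁ hα₁) (hpos hV₂ hS₂ hα₂)
      hm hm0 perm htan)

theorem contDiff_pullback_dTheta {α : OneForm} {V : Set Solid} (hV : IsOpen V) (hS : core ⊆ V)
    (hα : SmoothOn α V) :
    ContDiff ℝ ∞ fun t : ℝ => α (coverMap (t, 0)) (dTheta (t, 0)) := by
  rw [contDiff_iff_contDiffAt]
  intro t
  have h1 := contDiffAt_pullback hα hV (z := (t, 0)) (hS (coverMap_mem_core.2 rfl))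
  exact (h1.comp t (contDiffAt_id.prodMk contDiffAt_const)).clm_apply contDiffAt_const

theorem pullback_dTheta_add_two_pi (α : OneForm) (t : ℝ) :
    α (coverMap (t + 2 * Real.pi, 0)) (dTheta (t + 2 * Real.pi, 0)) =
      α (coverMap (t, 0)) (dTheta (t, 0)) := by
  have h := DFunLike.congr_fun (pullback_add_period α (t, 0)) eθ
  have h2 : ((t, 0) : Cover) + period = (t + 2 * Real.pi, 0) := by simp [period]
  rw [h2] at h
  exact h

end Descent

end ContactNbhd

end

theorem mainTheorem2
    (α₁ α₂ : ContactNbhd.OneForm) (V₁ V₂ : Set ContactNbhd.Solid)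
    (hV₁ : IsOpen V₁) (hV₂ : IsOpen V₂)
    (hS₁ : ContactNbhd.core ⊆ V₁) (hS₂ : ContactNbhd.core ⊆ V₂)
    (hα₁ : ContactNbhd.IsPositiveContactFormOn α₁ V₁)
    (hα₂ : ContactNbhd.IsPositiveContactFormOn α₂ V₂) :
    -- arbitrary knots
    ((∃ μ : Circle → ℝ, ContMDiff (𝓡 1) 𝓘(ℝ, ℝ) ∞ μ ∧ (∀ s, 0 < μ s) ∧
        ∀ t : ℝ, α₁ (ContactNbhd.coverMap (t, 0)) (ContactNbhd.dTheta (t, 0)) =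
          μ (Circle.exp t) * α₂ (ContactNbhd.coverMap (t, 0)) (ContactNbhd.dTheta (t, 0))) →
      ContactNbhd.ContactomorphicNearCore α₁ α₂ V₁ V₂) ∧
    -- the special case of Legendrian knots
    ((∀ t : ℝ, α₁ (ContactNbhd.coverMap (t, 0)) (ContactNbhd.dTheta (t, 0)) = 0 ∧
        α₂ (ContactNbhd.coverMap (t, 0)) (ContactNbhd.dTheta (t, 0)) = 0) →
      ContactNbhd.ContactomorphicNearCore α₁ α₂ V₁ V₂) ∧
    -- the special case of transverse knots
    ((∀ t : ℝ, α₁ (ContactNbhd.coverMap (t, 0)) (ContactNbhd.dTheta (t, 0)) ≠ 0 ∧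
        α₂ (ContactNbhd.coverMap (t, 0)) (ContactNbhd.dTheta (t, 0)) ≠ 0) →
      ContactNbhd.ContactomorphicNearCore α₁ α₂ V₁ V₂) := by
  refine ⟨?_, fun h => ?_, fun h => ?_⟩
  · rintro ⟨μ, hμ, hμ0, htan⟩
    exact ContactNbhd.contactomorphicNearCore_of_tangential hV₁ hV₂ hS₁ hS₂ hα₁ hα₂
      (m := fun t => μ (Circle.exp t)) (hμ.comp contMDiff_circleExp).contDiff
      (fun t => (hμ0 _).ne') (fun t => by rw [Circle.exp_add_two_pi]) htan
  · exact ContactNbhd.contactomorphicNearCore_of_tangential hV₁ hV₂ hS₁ hS₂ hα₁ hα₂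
      (m := fun _ => 1) contDiff_const (fun _ => one_ne_zero) (fun _ => rfl)
      (fun t => by rw [(h t).1, (h t).2, mul_zero])
  -- The quotient may be negative, so this case does not follow from the first one; it needs the
  -- version in which m is only nonvanishing.
  · exact ContactNbhd.contactomorphicNearCore_of_tangential hV₁ hV₂ hS₁ hS₂ hα₁ hα₂
      (m := fun t => α₁ (ContactNbhd.coverMap (t, 0)) (ContactNbhd.dTheta (t, 0)) /
        α₂ (ContactNbhd.coverMap (t, 0)) (ContactNbhd.dTheta (t, 0)))
      ((ContactNbhd.contDiff_pullback_dTheta hV₁ hS₁ hα₁.1).div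
        (ContactNbhd.contDiff_pullback_dTheta hV₂ hS₂ hα₂.1) fun t => (h t).2)
      (fun t => div_ne_zero (h t).1 (h t).2)
      (fun t => by simp only [ContactNbhd.pullback_dTheta_add_two_pi])
      (fun t => (div_mul_cancel₀ _ (h t).2).symm)
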